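/- All spaces are pointed. A pointed CW complex is a (Hausdorff) CW complex whose base point $*$ is a vertex; $\Sigma$ denotes the reduced suspension, $\simeq$ denotes pointed homotopy equivalence, and products of CW complexes are formed in compactly generated spaces (that is, they carry the k-ification of the product topology). For an integer $n\ge 0$, a pointed CW complex $X$ is called an $S^nS$-space if there is a pointed CW complex $Y$ with $\Sigma^n X\simeq \Sigma^{n+1}Y$. For pointed CW complexes $X_1,\dots,X_k$ and $0\le l\le k$, the $l$-th stage of the Whitehead filtration of $X_1\times\cdots\times X_k$ is the subspace $$T^k_l=\{(x_1,\dots,x_k)\in X_1\times\cdots\times X_k \;:\; x_i=* \text{ for at least } k-l \text{ indices } i\},$$ with base point $(*,\dots,*)$; thus $T^k_0=*$, $T^k_1=X_1\vee\cdots\vee X_k$ and $T^k_k=X_1\times\cdots\times X_k$. **Lemma.** Let $n,k,l$ be integers with $n\ge 0$ and $0\le l\le k$, and suppose that $n\ge 1$ or $l\le 1$. If $X_1,\dots,X_k$ are $S^nS$-spaces, then $T^k_l$ is an $S^nS$-space (in particular, it is a CW complex). -/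

import Mathlib

universe u

/-- A pointed topological space. -/
structure PtdSpace : Type (u + 1) where
  carrier : Type u
  [top : TopologicalSpace carrier]
  pt : carrier

namespace PtdSpace

instance : CoeSort PtdSpace.{u} (Type u) := ⟨PtdSpace.carrier⟩

instance (X : PtdSpace.{u}) : TopologicalSpace X := X.top

/-- A pointed CW complex: a Hausdorff space that admits a CW structure having the base point
as a vertex (that is, as one of the 0-cells). -/
def IsCW (X : PtdSpace.{u}) : Prop :=
  T2Space X ∧ ∃ (_ : Topology.CWComplex (Set.univ : Set X))
    (e : Topology.RelCWComplex.cell (Set.univ : Set X) 0),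
    Topology.RelCWComplex.closedCell (C := (Set.univ : Set X)) 0 e = {X.pt}

/-- Pointed homotopy equivalence `X ≃ Y`. -/
def HomotopyEquivalent (X Y : PtdSpace.{u}) : Prop :=
  ∃ (f : C(X, Y)) (g : C(Y, X)), f X.pt = Y.pt ∧ g Y.pt = X.pt ∧
    (g.comp f).HomotopicRel (ContinuousMap.id X) {X.pt} ∧
    (f.comp g).HomotopicRel (ContinuousMap.id Y) {Y.pt}

/-- The subset `X × {0, 1} ∪ {*} × [0, 1]` of the cylinder `X × [0, 1]`. -/
def suspBase (X : PtdSpace.{u}) : Set (X × unitInterval) :=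
  {p | p.1 = X.pt ∨ p.2 = 0 ∨ p.2 = 1}

/-- The equivalence relation on `X × [0, 1]` that identifies all points of `suspBase X`. -/
def suspSetoid (X : PtdSpace.{u}) : Setoid (X × unitInterval) where
  r p q := p = q ∨ (p ∈ X.suspBase ∧ q ∈ X.suspBase)
  iseqv :=
    { refl := fun _ => Or.inl rfl
      symm := by
        rintro p q (h | h)
        · exact Or.inl h.symm
        · exact Or.inr ⟨h.2, h.1⟩
      trans := by
        rintro p q r (rfl | h) (rfl | h')
        · exact Or.inl rfl
        · exact Or.inr h'
        · exact Or.inr h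
        · exact Or.inr ⟨h.1, h'.2⟩ }

/-- The reduced suspension `ΣX = (X × [0, 1]) / (X × {0, 1} ∪ {*} × [0, 1])`, with the quotient
topology. -/
def susp (X : PtdSpace.{u}) : PtdSpace.{u} where
  carrier := Quotient X.suspSetoid
  pt := Quotient.mk X.suspSetoid (X.pt, 0)

/-- `X` is an `SⁿS`-space: `X` is a (pointed) CW complex and there is a (pointed) CW complex `Y`
such that the iterated suspensions `Σⁿ X` and `Σⁿ⁺¹ Y` are homotopy equivalent. -/
def IsSnS (n : ℕ) (X : PtdSpace.{u}) : Prop :=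
  X.IsCW ∧ ∃ Y : PtdSpace.{u}, Y.IsCW ∧ HomotopyEquivalent (susp^[n] X) (susp^[n + 1] Y)

/-- The stage `T^k_l` of the Whitehead filtration of `X₁ × ⋯ × X_k`: the points that have at least
`k - l` coordinates equal to the base point. As usual for CW complexes, the product is formed in
compactly generated spaces, i.e. it carries the k-ification of the product topology; the stage
has the subspace topology. -/
noncomputable def whiteheadStage {k : ℕ} (X : Fin k → PtdSpace.{u}) (l : ℕ) : PtdSpace.{u} where
  carrier := {x : CompactCoherentification (∀ i, X i) //
    k - l ≤ {i | (CompactCoherentification.mk (∀ i, X i)).symm x i = (X i).pt}.ncard}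
  pt := ⟨CompactCoherentification.mk (∀ i, X i) fun i => (X i).pt, by simp⟩

end PtdSpace

/-! The proof is an induction on the number of factors. Let T be the stage `l + 1` for X₀, …, X_k,
let B ⊆ T consist of the tuples with x₀ = *, which is the stage `l + 1` for the remaining factors,
and let A be the stage `l` for the remaining factors. Dropping x₀ is a retraction T → B. A tuple
with x₀ ≠ * has its tail in A, so T/B is the half-smash product X₀ ⋊ A = (X₀ × A)/({*} × A)
(`stageCofibreSplit`).

As B is a subcomplex and a retract, T splits after one suspension: ΣT ≃ ΣB ∨ Σ(X₀ ⋊ A)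
(`CofibreSplit.susp_homotopyEquivalent`). The equivalence is written down by hand, with calculations
in the groups [K, ΩZ], so no connectivity is needed. Suspension commutes with wedges (`susp_wedge`)
and with half-smash products, Σ(X ⋊ A) ≅ ΣX ⋊ A (`susp_halfSmash`). Hence, if ΣⁿX₀ ≃ Σⁿ⁺¹Y, then
Σⁿ(X₀ ⋊ A) ≅ ΣⁿX₀ ⋊ A ≃ Σⁿ⁺¹Y ⋊ A ≅ Σⁿ⁺¹(Y ⋊ A), where A only has to be a CW complex. With ΣⁿB ≃
Σⁿ⁺¹Y' from the induction, ΣⁿT ≃ Σⁿ⁺¹(Y' ∨ (Y ⋊ A)) for n ≥ 1. For n = 0 only the first stage is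
left, and it is B ∨ X₀ without any suspension (`whiteheadStage_one`).

The rest is point-set topology. Cell structures are given by characteristic maps on cubes, since a
product of cubes is a cube. They yield the homotopy extension property (`CellStructure.hep`) and CW
structures on wedges, half-smash products and stages. Products are k-ified, so continuity and
closedness are tested on compact sets, and a compact set meets only finitely many open cells. -/

namespace PtdSpace

open Topology unitInterval

/-! ### Pointed maps and pointed homotopies -/

/-- Pointed maps. -/
structure PMap (X Y : PtdSpace.{u}) where
  toFun : X → Y
  cont : Continuous toFun
  map_pt : toFun X.pt = Y.pt

namespace PMap

variable {X Y Z W : PtdSpace.{u}}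

instance : CoeFun (PMap X Y) fun _ => X → Y := ⟨PMap.toFun⟩

@[simp] theorem coe_mk (f : X → Y) (hf h) : ((⟨f, hf, h⟩ : PMap X Y) : X → Y) = f := rfl

@[simp] theorem apply_pt (f : PMap X Y) : f X.pt = Y.pt := f.map_pt

@[ext] theorem ext {f g : PMap X Y} (h : ∀ x, f x = g x) : f = g := by
  cases f; cases g; congr; exact funext h

/-- The underlying continuous map. -/
def toC (f : PMap X Y) : C(X, Y) := ⟨f, f.cont⟩

/-- The identity. -/
protected def id (X : PtdSpace.{u}) : PMap X X := ⟨fun x => x, continuous_id, rfl⟩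

/-- Composition. -/
def comp (g : PMap Y Z) (f : PMap X Y) : PMap X Z := ⟨fun x => g (f x), g.cont.comp f.cont, by simp⟩

@[simp] theorem comp_apply (g : PMap Y Z) (f : PMap X Y) (x : X) : g.comp f x = g (f x) := rfl

@[simp] theorem id_apply (x : X) : PMap.id X x = x := rfl

/-- The constant map. -/
def const (X Y : PtdSpace.{u}) : PMap X Y := ⟨fun _ => Y.pt, continuous_const, rfl⟩

@[simp] theorem const_apply (x : X) : const X Y x = Y.pt := rfl

/-- Pointed homotopy. -/
def Homotopic (f g : PMap X Y) : Prop := f.toC.HomotopicRel g.toC {X.pt}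

theorem homotopic_iff {f g : PMap X Y} : f.Homotopic g ↔ ∃ H : X × I → Y, Continuous H ∧
    (∀ x, H (x, 0) = f x) ∧ (∀ x, H (x, 1) = g x) ∧ ∀ t, H (X.pt, t) = Y.pt := by
  constructor
  · rintro ⟨H⟩
    refine ⟨fun p => H (p.2, p.1), by fun_prop, fun x => H.apply_zero x, fun x => H.apply_one x,
      fun t => ?_⟩
    exact (H.eq_fst t rfl).trans f.map_pt
  · rintro ⟨H, hc, h0, h1, hp⟩
    exact ⟨⟨⟨⟨fun p => H (p.2, p.1), by fun_prop⟩, h0, h1⟩,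
      fun t x hx => by
        rw [Set.mem_singleton_iff] at hx
        subst hx
        exact (hp t).trans f.map_pt.symm⟩⟩

theorem Homotopic.refl (f : PMap X Y) : f.Homotopic f := ContinuousMap.HomotopicRel.refl _

theorem Homotopic.of_eq {f g : PMap X Y} (h : f = g) : f.Homotopic g := h ▸ .refl _

theorem Homotopic.symm {f g : PMap X Y} (h : f.Homotopic g) : g.Homotopic f :=
  ContinuousMap.HomotopicRel.symm h

theorem Homotopic.trans {f g h : PMap X Y} (h₁ : f.Homotopic g) (h₂ : g.Homotopic h) :
    f.Homotopic h :=
  ContinuousMap.HomotopicRel.trans h₁ h₂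

theorem Homotopic.comp_left {f g : PMap X Y} (h : f.Homotopic g) (k : PMap Y Z) :
    (k.comp f).Homotopic (k.comp g) := by
  obtain ⟨H, hc, h0, h1, hp⟩ := homotopic_iff.1 h
  exact homotopic_iff.2 ⟨fun p => k (H p), k.cont.comp hc, by simp [h0], by simp [h1], by simp [hp]⟩

theorem Homotopic.comp_right {f g : PMap Y Z} (h : f.Homotopic g) (k : PMap X Y) :
    (f.comp k).Homotopic (g.comp k) := by
  obtain ⟨H, hc, h0, h1, hp⟩ := homotopic_iff.1 h
  have := k.cont
  exact homotopic_iff.2 ⟨fun p => H (k p.1, p.2), by fun_prop, by simp [h0], by simp [h1],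
    by simp [hp]⟩

end PMap

open PMap

variable {X Y Z W A B : PtdSpace.{u}}

theorem homotopyEquivalent_iff : HomotopyEquivalent X Y ↔ ∃ (f : PMap X Y) (g : PMap Y X),
    (g.comp f).Homotopic (.id X) ∧ (f.comp g).Homotopic (.id Y) := by
  constructor
  · rintro ⟨f, g, hf, hg, h1, h2⟩
    exact ⟨⟨f, f.continuous, hf⟩, ⟨g, g.continuous, hg⟩, h1, h2⟩
  · rintro ⟨f, g, h1, h2⟩
    exact ⟨f.toC, g.toC, f.map_pt, g.map_pt, h1, h2⟩

namespace HomotopyEquivalent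

theorem of_inverse (f : PMap X Y) (g : PMap Y X) (h1 : ∀ x, g (f x) = x) (h2 : ∀ y, f (g y) = y) :
    HomotopyEquivalent X Y :=
  homotopyEquivalent_iff.2 ⟨f, g, .of_eq (PMap.ext h1), .of_eq (PMap.ext h2)⟩

theorem refl (X : PtdSpace.{u}) : HomotopyEquivalent X X :=
  of_inverse (.id X) (.id X) (fun _ => rfl) fun _ => rfl

theorem symm (h : HomotopyEquivalent X Y) : HomotopyEquivalent Y X := by
  obtain ⟨f, g, h1, h2⟩ := homotopyEquivalent_iff.1 h
  exact homotopyEquivalent_iff.2 ⟨g, f, h2, h1⟩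

theorem trans (h : HomotopyEquivalent X Y) (h' : HomotopyEquivalent Y Z) :
    HomotopyEquivalent X Z := by
  obtain ⟨f, g, h1, h2⟩ := homotopyEquivalent_iff.1 h
  obtain ⟨f', g', h1', h2'⟩ := homotopyEquivalent_iff.1 h'
  exact homotopyEquivalent_iff.2 ⟨f'.comp f, g.comp g',
    ((h1'.comp_right f).comp_left g).trans h1, ((h2.comp_right g').comp_left f').trans h2'⟩

end HomotopyEquivalent

theorem HomotopyEquivalent.of_subsingleton [Subsingleton X] [Subsingleton Y] :
    HomotopyEquivalent X Y :=
  .of_inverse (.const X Y) (.const Y X) (fun _ => Subsingleton.elim _ _)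
    fun _ => Subsingleton.elim _ _

/-! ### Suspensions -/

/-- The point `[x, t]` of the suspension. -/
def suspMk (X : PtdSpace.{u}) (p : X × I) : X.susp := Quotient.mk X.suspSetoid p

theorem isQuotientMap_suspMk : IsQuotientMap (suspMk X) := isQuotientMap_quotient_mk'

@[fun_prop] theorem continuous_suspMk : Continuous (suspMk X) := isQuotientMap_suspMk.continuous

theorem suspMk_eq_iff {p q : X × I} :
    suspMk X p = suspMk X q ↔ p = q ∨ (p ∈ X.suspBase ∧ q ∈ X.suspBase) := Quotient.eq

theorem suspMk_surjective : Function.Surjective (suspMk X) := isQuotientMap_suspMk.surjective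

theorem susp_pt : X.susp.pt = suspMk X (X.pt, 0) := rfl

theorem suspMk_eq_pt_iff {p : X × I} : suspMk X p = X.susp.pt ↔ p ∈ X.suspBase := by
  rw [susp_pt, suspMk_eq_iff]
  have : (X.pt, (0 : I)) ∈ X.suspBase := Or.inl rfl
  constructor
  · rintro (rfl | h)
    · exact this
    · exact h.1
  · exact fun h => Or.inr ⟨h, this⟩

theorem suspMk_base {p : X × I} (h : p ∈ X.suspBase) : suspMk X p = X.susp.pt :=
  suspMk_eq_pt_iff.2 h

@[simp] theorem suspMk_pt (t : I) : suspMk X (X.pt, t) = X.susp.pt := suspMk_base (Or.inl rfl)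

@[simp] theorem suspMk_zero (x : X) : suspMk X (x, 0) = X.susp.pt :=
  suspMk_base (Or.inr (Or.inl rfl))

@[simp] theorem suspMk_one (x : X) : suspMk X (x, 1) = X.susp.pt :=
  suspMk_base (Or.inr (Or.inr rfl))

/-- The map out of a suspension induced by a map that is constant on `suspBase`. -/
def suspLift (g : X × I → Z) (hg : Continuous g) (hb : ∀ p ∈ X.suspBase, g p = Z.pt) :
    PMap X.susp Z where
  toFun := Quotient.lift g (by
    rintro p q (rfl | h)
    · rfl
    · rw [hb p h.1, hb q h.2])
  cont := hg.quotient_lift _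
  map_pt := hb _ (Or.inl rfl)

@[simp] theorem suspLift_mk (g : X × I → Z) (hg hb) (p : X × I) :
    suspLift g hg hb (suspMk X p) = g p := rfl

/-- Functoriality of the suspension. -/
def PMap.susp (f : PMap X Y) : PMap X.susp Y.susp :=
  suspLift (fun p => suspMk Y (f p.1, p.2)) (by have := f.cont; fun_prop) (by
    rintro ⟨x, t⟩ (h | h | h) <;> simp at h <;> subst h <;> simp)

@[simp] theorem PMap.susp_mk (f : PMap X Y) (p : X × I) :
    f.susp (suspMk X p) = suspMk Y (f p.1, p.2) := rfl

theorem PMap.Homotopic.susp {f g : PMap X Y} (h : f.Homotopic g) : f.susp.Homotopic g.susp := by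
  obtain ⟨H, hc, h0, h1, hp⟩ := homotopic_iff.1 h
  let G : X.susp × I → Y.susp := fun q =>
    Quotient.lift (fun p : X × I => suspMk Y (H (p.1, q.2), p.2)) (by
      have key : ∀ p ∈ X.suspBase, suspMk Y (H (p.1, q.2), p.2) = Y.susp.pt := by
        rintro ⟨x, t⟩ (h | h | h) <;> simp at h <;> subst h <;> simp [hp]
      rintro p p' (rfl | h)
      · rfl
      · exact (key p h.1).trans (key p' h.2).symm) q.1
  have hG : ∀ p t, G (suspMk X p, t) = suspMk Y (H (p.1, t), p.2) := fun _ _ => rfl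
  refine homotopic_iff.2 ⟨G, ?_, ?_, ?_, ?_⟩
  -- `I` is locally compact, so the product of `suspMk X` with the identity of `I` is still a
  -- quotient map.
  · refine isQuotientMap_suspMk.continuous_lift_prod_left ?_
    simp only [hG]
    fun_prop
  · intro x
    obtain ⟨p, rfl⟩ := suspMk_surjective x
    simp [hG, h0]
  · intro x
    obtain ⟨p, rfl⟩ := suspMk_surjective x
    simp [hG, h1]
  · intro t
    rw [susp_pt, hG]
    simp

theorem HomotopyEquivalent.susp (h : HomotopyEquivalent X Y) :
    HomotopyEquivalent X.susp Y.susp := by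
  obtain ⟨f, g, h1, h2⟩ := homotopyEquivalent_iff.1 h
  refine homotopyEquivalent_iff.2 ⟨f.susp, g.susp, ?_, ?_⟩
  · refine (Homotopic.of_eq ?_).trans (h1.susp.trans (.of_eq ?_)) <;>
    · ext x
      obtain ⟨p, rfl⟩ := suspMk_surjective x
      rfl
  · refine (Homotopic.of_eq ?_).trans (h2.susp.trans (.of_eq ?_)) <;>
    · ext x
      obtain ⟨p, rfl⟩ := suspMk_surjective x
      rfl

theorem HomotopyEquivalent.susp_iterate (h : HomotopyEquivalent X Y) (n : ℕ) :
    HomotopyEquivalent (PtdSpace.susp^[n] X) (PtdSpace.susp^[n] Y) := by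
  induction n with
  | zero => exact h
  | succ n ih =>
    rw [Function.iterate_succ_apply', Function.iterate_succ_apply']
    exact ih.susp

instance [Subsingleton X] : Subsingleton X.susp where
  allEq a b := by
    obtain ⟨⟨x, s⟩, rfl⟩ := suspMk_surjective a
    obtain ⟨⟨y, t⟩, rfl⟩ := suspMk_surjective b
    rw [Subsingleton.elim x X.pt, Subsingleton.elim y X.pt]
    simp

instance [h : Subsingleton X] (n : ℕ) : Subsingleton (susp^[n] X) := by
  induction n with
  | zero => exact h
  | succ n ih =>
    rw [Function.iterate_succ_apply']
    infer_instance

/-- An open set of `X × I` that contains `suspBase` or is disjoint from it is saturated, so its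
image is open. `key` separates the base point from the others; two other points are separated inside
the complement of `suspBase`. -/
instance susp_t2Space [T2Space X] : T2Space X.susp where
  t2 a b hab := by
    have key : ∀ (p : X × I), p ∉ X.suspBase → ∃ U V : Set X.susp, IsOpen U ∧ IsOpen V ∧
        suspMk X p ∈ U ∧ X.susp.pt ∈ V ∧ Disjoint U V := by
      rintro ⟨x, t⟩ hp
      have hx : x ≠ X.pt := fun h => hp (Or.inl h)
      have h0 : t ≠ 0 := fun h => hp (Or.inr (Or.inl h))
      have h1 : t ≠ 1 := fun h => hp (Or.inr (Or.inr h))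
      obtain ⟨U, V, hU, hV, hxU, hpV, hUV⟩ := t2_separation hx
      obtain ⟨S, S0, hS, hS0, htS, h0S, hSS⟩ := t2_separation h0
      obtain ⟨R, R1, hR, hR1, htR, h1R, hRR⟩ := t2_separation h1
      rw [Set.disjoint_left] at hUV hSS hRR
      let P : Set (X × I) := U ×ˢ (S ∩ R)
      let Q : Set (X × I) := {q | q.1 ∈ V ∨ q.2 ∈ S0 ∨ q.2 ∈ R1}
      have hP : IsOpen P := hU.prod (hS.inter hR)
      have hQ : IsOpen Q := (hV.preimage continuous_fst).union
        ((hS0.preimage continuous_snd).union (hR1.preimage continuous_snd))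
      have hPQ : ∀ q ∈ P, q ∉ Q := by
        rintro q ⟨h1, h2, h3⟩ (h | h | h)
        · exact hUV h1 h
        · exact hSS h2 h
        · exact hRR h3 h
      have hbQ : ∀ q ∈ X.suspBase, q ∈ Q := by
        rintro ⟨y, s⟩ (h | h | h) <;> simp at h <;> subst h
        · exact Or.inl hpV
        · exact Or.inr (Or.inl h0S)
        · exact Or.inr (Or.inr h1R)
      have sat : ∀ q, suspMk X q ∈ suspMk X '' P → q ∈ P := by
        rintro q ⟨r, hr, hrq⟩
        rcases suspMk_eq_iff.1 hrq with rfl | h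
        · exact hr
        · exact absurd (hbQ _ h.1) (hPQ _ hr)
      have satQ : ∀ q, suspMk X q ∈ suspMk X '' Q → q ∈ Q := by
        rintro q ⟨r, hr, hrq⟩
        rcases suspMk_eq_iff.1 hrq with rfl | h
        · exact hr
        · exact hbQ _ h.2
      refine ⟨suspMk X '' P, suspMk X '' Q, ?_, ?_, ⟨_, ⟨hxU, htS, htR⟩, rfl⟩,
        ⟨(X.pt, 0), Or.inl hpV, rfl⟩, ?_⟩
      · rw [← isQuotientMap_suspMk.isOpen_preimage]
        convert hP using 1
        exact Set.Subset.antisymm sat (Set.subset_preimage_image _ _)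
      · rw [← isQuotientMap_suspMk.isOpen_preimage]
        convert hQ using 1
        exact Set.Subset.antisymm satQ (Set.subset_preimage_image _ _)
      · rw [Set.disjoint_left]
        rintro _ ⟨q, hq, rfl⟩ h
        exact hPQ q hq (satQ q h)
    obtain ⟨p, rfl⟩ := suspMk_surjective a
    obtain ⟨q, rfl⟩ := suspMk_surjective b
    by_cases hp : p ∈ X.suspBase
    · have hq : q ∉ X.suspBase := fun hq => hab (by rw [suspMk_base hp, suspMk_base hq])
      obtain ⟨U, V, hU, hV, h1, h2, h3⟩ := key q hq
      exact ⟨V, U, hV, hU, by rwa [suspMk_base hp], h1, h3.symm⟩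
    by_cases hq : q ∈ X.suspBase
    · obtain ⟨U, V, hU, hV, h1, h2, h3⟩ := key p hp
      exact ⟨U, V, hU, hV, h1, by rwa [suspMk_base hq], h3⟩
    have hc : IsOpen (X.suspBaseᶜ) := by
      rw [isOpen_compl_iff]
      have h1 : IsClosed {p : X × I | p.1 = X.pt} := isClosed_eq continuous_fst continuous_const
      have h2 : IsClosed {p : X × I | p.2 = 0} := isClosed_eq continuous_snd continuous_const
      have h3 : IsClosed {p : X × I | p.2 = 1} := isClosed_eq continuous_snd continuous_const
      exact h1.union (h2.union h3)
    obtain ⟨U, V, hU, hV, hpU, hqV, hUV⟩ := t2_separation (x := p) (y := q) fun h => hab (h ▸ rfl)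
    have inj : ∀ (U : Set (X × I)) q, suspMk X q ∈ suspMk X '' (U ∩ X.suspBaseᶜ) →
        q ∈ U ∩ X.suspBaseᶜ := by
      rintro U q ⟨r, hr, hrq⟩
      rcases suspMk_eq_iff.1 hrq with rfl | h
      · exact hr
      · exact absurd h.1 hr.2
    refine ⟨suspMk X '' (U ∩ X.suspBaseᶜ), suspMk X '' (V ∩ X.suspBaseᶜ), ?_, ?_,
      ⟨p, ⟨hpU, hp⟩, rfl⟩, ⟨q, ⟨hqV, hq⟩, rfl⟩, ?_⟩
    · rw [← isQuotientMap_suspMk.isOpen_preimage]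
      convert hU.inter hc using 1
      exact Set.Subset.antisymm (inj U) (Set.subset_preimage_image _ _)
    · rw [← isQuotientMap_suspMk.isOpen_preimage]
      convert hV.inter hc using 1
      exact Set.Subset.antisymm (inj V) (Set.subset_preimage_image _ _)
    · rw [Set.disjoint_left]
      rintro _ ⟨r, hr, rfl⟩ h
      exact Set.disjoint_left.1 hUV hr.1 (inj V r h).1

theorem susp_iterate_t2Space [h : T2Space X] (n : ℕ) : T2Space (susp^[n] X) := by
  induction n with
  | zero => exact h
  | succ n ih =>
    rw [Function.iterate_succ_apply']
    infer_instance

/-! ### Wedges -/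

/-- The wedge, as a subspace of the product. -/
def wedge (A B : PtdSpace.{u}) : PtdSpace.{u} where
  carrier := {p : A × B // p.1 = A.pt ∨ p.2 = B.pt}
  pt := ⟨(A.pt, B.pt), Or.inl rfl⟩

@[simp] theorem wedge_pt_val : (wedge A B).pt.1 = (A.pt, B.pt) := rfl

instance [T2Space A] [T2Space B] : T2Space (wedge A B) :=
  inferInstanceAs (T2Space {p : A × B // p.1 = A.pt ∨ p.2 = B.pt})

/-- The first inclusion. -/
def wedgeInl (A B : PtdSpace.{u}) : PMap A (wedge A B) where
  toFun a := ⟨(a, B.pt), Or.inr rfl⟩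
  cont := by
    refine Continuous.subtype_mk ?_ _
    fun_prop
  map_pt := rfl

/-- The second inclusion. -/
def wedgeInr (A B : PtdSpace.{u}) : PMap B (wedge A B) where
  toFun b := ⟨(A.pt, b), Or.inl rfl⟩
  cont := by
    refine Continuous.subtype_mk ?_ _
    fun_prop
  map_pt := rfl

theorem wedge_cases (p : wedge A B) : (∃ a, p = wedgeInl A B a) ∨ ∃ b, p = wedgeInr A B b := by
  obtain ⟨⟨a, b⟩, h | h⟩ := p <;> simp at h <;> subst h
  · exact Or.inr ⟨b, rfl⟩
  · exact Or.inl ⟨a, rfl⟩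

/-- Both summands are closed because base points are closed, so continuity can be glued. The factor
`P` is there for homotopies. -/
theorem continuous_wedge_prod {P Q : Type*} [TopologicalSpace P] [TopologicalSpace Q]
    [T1Space A] [T1Space B] {h : wedge A B × P → Q}
    (h1 : Continuous fun p : A × P => h (wedgeInl A B p.1, p.2))
    (h2 : Continuous fun p : B × P => h (wedgeInr A B p.1, p.2)) : Continuous h := by
  have c1 : Continuous fun p : wedge A B × P => p.1.1.1 :=
    continuous_fst.comp (continuous_subtype_val.comp continuous_fst)
  have c2 : Continuous fun p : wedge A B × P => p.1.1.2 :=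
    continuous_snd.comp (continuous_subtype_val.comp continuous_fst)
  have s1 : IsClosed {p : wedge A B × P | p.1.1.2 = B.pt} := isClosed_singleton.preimage c2
  have s2 : IsClosed {p : wedge A B × P | p.1.1.1 = A.pt} := isClosed_singleton.preimage c1
  have o1 : ContinuousOn h {p : wedge A B × P | p.1.1.2 = B.pt} := by
    refine (h1.comp (c1.prodMk continuous_snd)).continuousOn.congr ?_
    rintro ⟨⟨⟨a, b⟩, hab⟩, p⟩ hp
    simp only [Set.mem_ofPred_eq] at hp
    subst hp
    rfl
  have o2 : ContinuousOn h {p : wedge A B × P | p.1.1.1 = A.pt} := by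
    refine (h2.comp (c2.prodMk continuous_snd)).continuousOn.congr ?_
    rintro ⟨⟨⟨a, b⟩, hab⟩, p⟩ hp
    simp only [Set.mem_ofPred_eq] at hp
    subst hp
    rfl
  rw [← continuousOn_univ]
  refine (o1.union_of_isClosed o2 s1 s2).mono ?_
  rintro ⟨⟨⟨a, b⟩, hab⟩, p⟩ -
  exact hab.symm

theorem continuous_wedge {Q : Type*} [TopologicalSpace Q]
    [T1Space A] [T1Space B] {h : wedge A B → Q}
    (h1 : Continuous fun p => h (wedgeInl A B p))
    (h2 : Continuous fun p => h (wedgeInr A B p)) : Continuous h := by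
  have := continuous_wedge_prod (P := Unit) (h := fun p => h p.1) (h1.comp continuous_fst)
    (h2.comp continuous_fst)
  exact this.comp (Continuous.prodMk_left ())

open Classical in
/-- The map out of a wedge given by its restrictions. -/
noncomputable def wedgeDesc [T1Space A] [T1Space B] (f : PMap A Z) (g : PMap B Z) : PMap (wedge A B) Z where
  toFun p := if p.1.2 = B.pt then f p.1.1 else g p.1.2
  cont := by
    refine continuous_wedge ?_ ?_
    · simpa [wedgeInl] using f.cont
    · convert g.cont using 2 with b
      by_cases hb : b = B.pt <;> simp [wedgeInr, hb]
  map_pt := by simp [wedge]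

@[simp] theorem wedgeDesc_inl [T1Space A] [T1Space B] (f : PMap A Z) (g : PMap B Z) (a : A) :
    wedgeDesc f g (wedgeInl A B a) = f a := by simp [wedgeDesc, wedgeInl]

@[simp] theorem wedgeDesc_inr [T1Space A] [T1Space B] (f : PMap A Z) (g : PMap B Z) (b : B) :
    wedgeDesc f g (wedgeInr A B b) = g b := by
  by_cases hb : b = B.pt <;> simp [wedgeDesc, wedgeInr, hb]

theorem PMap.Homotopic.of_wedge [T1Space A] [T1Space B] {f g : PMap (wedge A B) Z}
    (hl : (f.comp (wedgeInl A B)).Homotopic (g.comp (wedgeInl A B)))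
    (hr : (f.comp (wedgeInr A B)).Homotopic (g.comp (wedgeInr A B))) : f.Homotopic g := by
  classical
  obtain ⟨H, hc, h0, h1, hp⟩ := homotopic_iff.1 hl
  obtain ⟨K, kc, k0, k1, kp⟩ := homotopic_iff.1 hr
  let G : wedge A B × I → Z := fun p =>
    if p.1.1.2 = B.pt then H (p.1.1.1, p.2) else K (p.1.1.2, p.2)
  have gl : ∀ a t, G (wedgeInl A B a, t) = H (a, t) := by simp [G, wedgeInl]
  have gr : ∀ b t, G (wedgeInr A B b, t) = K (b, t) := by
    intro b t
    by_cases hb : b = B.pt <;> simp [G, wedgeInr, hb, hp, kp]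
  refine homotopic_iff.2 ⟨G, continuous_wedge_prod ?_ ?_, ?_, ?_, ?_⟩
  · simpa only [gl] using hc
  · simpa only [gr] using kc
  · intro p
    rcases wedge_cases p with ⟨a, rfl⟩ | ⟨b, rfl⟩
    · rw [gl, h0]; rfl
    · rw [gr, k0]; rfl
  · intro p
    rcases wedge_cases p with ⟨a, rfl⟩ | ⟨b, rfl⟩
    · rw [gl, h1]; rfl
    · rw [gr, k1]; rfl
  · intro t
    exact (gl A.pt t).trans (hp t)

/-- Functoriality of the wedge. -/
def PMap.wedge (f : PMap X Y) (g : PMap Z W) : PMap (wedge X Z) (wedge Y W) where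
  toFun p := ⟨(f p.1.1, g p.1.2), p.2.imp (fun h => by simp [h]) fun h => by simp [h]⟩
  cont := by
    refine Continuous.subtype_mk ?_ _
    exact (f.cont.comp (continuous_fst.comp continuous_subtype_val)).prodMk
      (g.cont.comp (continuous_snd.comp continuous_subtype_val))
  map_pt := by
    refine Subtype.ext ?_
    simp [PtdSpace.wedge]

theorem HomotopyEquivalent.wedge (h : HomotopyEquivalent X Y) (h' : HomotopyEquivalent Z W) :
    HomotopyEquivalent (wedge X Z) (PtdSpace.wedge Y W) := by
  have key : ∀ {X Z : PtdSpace.{u}} {f : PMap X X} {g : PMap Z Z}, f.Homotopic (.id X) →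
      g.Homotopic (.id Z) → (f.wedge g).Homotopic (.id _) := by
    intro X Z f g h1 h2
    obtain ⟨H, hc, h0, h1, hp⟩ := homotopic_iff.1 h1
    obtain ⟨K, kc, k0, k1, kp⟩ := homotopic_iff.1 h2
    refine homotopic_iff.2 ⟨fun p => ⟨(H (p.1.1.1, p.2), K (p.1.1.2, p.2)),
      p.1.2.imp (fun h => by simp [h, hp]) fun h => by simp [h, kp]⟩, ?_, ?_, ?_, ?_⟩
    · refine Continuous.subtype_mk ?_ _
      have c0 : Continuous fun p : PtdSpace.wedge X Z × I => (p.1.1 : X × Z) :=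
        continuous_subtype_val.comp continuous_fst
      fun_prop
    · intro p
      exact Subtype.ext (Prod.ext (h0 _) (k0 _))
    · intro p
      exact Subtype.ext (Prod.ext (h1 _) (k1 _))
    · intro t
      exact Subtype.ext (Prod.ext (hp _) (kp _))
  obtain ⟨f, g, h1, h2⟩ := homotopyEquivalent_iff.1 h
  obtain ⟨f', g', h1', h2'⟩ := homotopyEquivalent_iff.1 h'
  exact homotopyEquivalent_iff.2 ⟨f.wedge f', g.wedge g', key h1 h1', key h2 h2'⟩

/-- The suspension commutes with wedges. -/
theorem susp_wedge [T2Space A] [T2Space B] :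
    HomotopyEquivalent (wedge A B).susp (wedge A.susp B.susp) := by
  let f : PMap (wedge A B).susp (wedge A.susp B.susp) :=
    suspLift (fun p => ⟨(suspMk A (p.1.1.1, p.2), suspMk B (p.1.1.2, p.2)),
      p.1.2.imp (fun h => by simp [h]) fun h => by simp [h]⟩)
      (by
        refine Continuous.subtype_mk ?_ _
        have c0 : Continuous fun p : PtdSpace.wedge A B × I => (p.1.1 : A × B) :=
          continuous_subtype_val.comp continuous_fst
        fun_prop)
      (by
        rintro ⟨p, t⟩ (h | h | h) <;> simp at h <;> subst h <;> refine Subtype.ext ?_ <;>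
          simp [wedge])
  refine .of_inverse f (wedgeDesc (wedgeInl A B).susp (wedgeInr A B).susp) ?_ ?_
  · intro x
    obtain ⟨⟨p, t⟩, rfl⟩ := suspMk_surjective x
    rcases wedge_cases p with ⟨a, rfl⟩ | ⟨b, rfl⟩
    · have : f (suspMk _ (wedgeInl A B a, t)) = wedgeInl _ _ (suspMk A (a, t)) := by
        exact Subtype.ext (Prod.ext rfl (suspMk_pt t))
      rw [this, wedgeDesc_inl, PMap.susp_mk]
    · have : f (suspMk _ (wedgeInr A B b, t)) = wedgeInr _ _ (suspMk B (b, t)) := by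
        exact Subtype.ext (Prod.ext (suspMk_pt t) rfl)
      rw [this, wedgeDesc_inr, PMap.susp_mk]
  · intro p
    rcases wedge_cases p with ⟨a, rfl⟩ | ⟨b, rfl⟩
    · obtain ⟨⟨a, t⟩, rfl⟩ := suspMk_surjective a
      rw [wedgeDesc_inl, PMap.susp_mk]
      exact Subtype.ext (Prod.ext rfl (suspMk_pt t))
    · obtain ⟨⟨a, t⟩, rfl⟩ := suspMk_surjective b
      rw [wedgeDesc_inr, PMap.susp_mk]
      exact Subtype.ext (Prod.ext (suspMk_pt t) rfl)

theorem susp_iterate_wedge [hA : T2Space A] [hB : T2Space B] (n : ℕ) :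
    HomotopyEquivalent (susp^[n] (wedge A B)) (wedge (susp^[n] A) (susp^[n] B)) := by
  induction n with
  | zero => exact .refl _
  | succ n ih =>
    simp only [Function.iterate_succ_apply']
    have := susp_iterate_t2Space (X := A) n
    have := susp_iterate_t2Space (X := B) n
    exact ih.susp.trans susp_wedge

end PtdSpace

namespace PtdSpace

open Topology unitInterval

open PMap

variable {X Y Z W A B K L T Q : PtdSpace.{u}}

/-! ### Loop spaces -/

/-- The loop space. -/
def loop (Z : PtdSpace.{u}) : PtdSpace.{u} where
  carrier := Path Z.pt Z.pt
  pt := Path.refl Z.pt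

theorem continuous_loop_iff {P : Type*} [TopologicalSpace P] {g : P → loop Z} :
    Continuous g ↔ Continuous fun p : P × I => (show Path Z.pt Z.pt from g p.1) p.2 :=
  Path.continuous_uncurry_iff.symm

@[ext] theorem loop_ext {a b : loop Z}
    (h : ∀ t, (show Path Z.pt Z.pt from a) t = (show Path Z.pt Z.pt from b) t) : a = b :=
  Path.ext (funext h)

/-- Evaluation of loops. -/
def ev (γ : loop Z) (t : I) : Z := (show Path Z.pt Z.pt from γ) t

theorem continuous_ev : Continuous fun p : loop Z × I => ev p.1 p.2 :=
  continuous_loop_iff.1 continuous_id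

@[fun_prop] theorem continuous_ev' {P : Type*} [TopologicalSpace P] {g : P → loop Z} {h : P → I}
    (hg : Continuous g) (hh : Continuous h) : Continuous fun p => ev (g p) (h p) :=
  continuous_ev.comp (hg.prodMk hh)

@[simp] theorem ev_zero (γ : loop Z) : ev γ 0 = Z.pt := Path.source _

@[simp] theorem ev_one (γ : loop Z) : ev γ 1 = Z.pt := Path.target _

@[simp] theorem ev_pt (t : I) : ev (loop Z).pt t = Z.pt := rfl

/-- Construct a loop. -/
def mkLoop (f : I → Z) (hf : Continuous f) (h0 : f 0 = Z.pt) (h1 : f 1 = Z.pt) : loop Z :=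
  (⟨⟨f, hf⟩, h0, h1⟩ : Path Z.pt Z.pt)

@[simp] theorem ev_mkLoop (f : I → Z) (hf h0 h1) (t : I) : ev (mkLoop f hf h0 h1) t = f t := rfl

/-- Concatenation of loops. -/
noncomputable def cat (a b : loop Z) : loop Z :=
  Path.trans (show Path Z.pt Z.pt from a) (show Path Z.pt Z.pt from b)

@[fun_prop] theorem continuous_cat {P : Type*} [TopologicalSpace P] {g h : P → loop Z}
    (hg : Continuous g) (hh : Continuous h) : Continuous fun p => cat (g p) (h p) :=
  Continuous.path_trans hg hh

/-- The reverse loop. -/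
def rev (a : loop Z) : loop Z := Path.symm (show Path Z.pt Z.pt from a)

@[fun_prop] theorem continuous_rev {P : Type*} [TopologicalSpace P] {g : P → loop Z}
    (hg : Continuous g) : Continuous fun p => rev (g p) :=
  Path.continuous_symm.comp hg

@[simp] theorem cat_pt : cat (loop Z).pt (loop Z).pt = (loop Z).pt := Path.refl_trans_refl

@[simp] theorem rev_pt : rev (loop Z).pt = (loop Z).pt := Path.refl_symm

/-! ### Reparametrization and contraction of loops -/

/-- The point `(1 - s) a + s b` of the unit interval. -/
def mix (s a b : I) : I := ⟨(1 - s) * a + s * b, by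
  have := (convex_Icc (0 : ℝ) 1) a.2 b.2 (sub_nonneg.2 s.2.2) s.2.1 (by ring)
  simpa using this⟩

@[fun_prop] theorem continuous_mix {P : Type*} [TopologicalSpace P] {f g h : P → I}
    (hf : Continuous f) (hg : Continuous g) (hh : Continuous h) :
    Continuous fun p => mix (f p) (g p) (h p) := by
  unfold mix
  fun_prop

@[simp] theorem mix_zero (a b : I) : mix 0 a b = a := by simp [mix]
@[simp] theorem mix_one (a b : I) : mix 1 a b = b := by simp [mix]
@[simp] theorem mix_self (s a : I) : mix s a a = a := by
  ext
  simp [mix]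
  ring

/-- The tent map. -/
noncomputable def tent (t : I) : I := ⟨1 - |1 - 2 * (t : ℝ)|, by
  have := t.2.1
  have := t.2.2
  constructor
  · rw [sub_nonneg, abs_le]
    constructor <;> linarith
  · have := abs_nonneg (1 - 2 * (t : ℝ))
    linarith⟩

@[fun_prop] theorem continuous_tent : Continuous tent := by
  unfold tent
  fun_prop

@[simp] theorem tent_zero : tent 0 = 0 := by ext; simp [tent]
@[simp] theorem tent_one : tent 1 = 0 := by ext; norm_num [tent]

theorem ev_cat_rev (γ : loop Z) (t : I) : ev (cat γ (rev γ)) t = ev γ (tent t) := by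
  unfold ev cat rev
  rw [Path.trans_apply]
  split_ifs with h
  · refine congrArg (ev γ) (Subtype.ext ?_)
    simp only [tent]
    rw [abs_of_nonneg (by linarith)]
    ring
  · rw [Path.symm_apply]
    refine congrArg (ev γ) (Subtype.ext ?_)
    simp only [tent, coe_symm_eq]
    rw [abs_of_nonpos (by linarith)]
    ring

/-- The contraction of `γ γ⁻¹` to the constant loop. -/
noncomputable def contractRev (γ : loop Z) (u : I) : loop Z :=
  -- At stage `u` the loop follows `γ` up to time `1 - u` and then returns.
  mkLoop (fun t => ev γ (mix u (tent t) 0)) (by fun_prop) (by simp) (by simp)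

@[simp] theorem contractRev_zero (γ : loop Z) : contractRev γ 0 = cat γ (rev γ) := by
  ext t
  exact (congrArg (ev γ) (mix_zero _ _)).trans (ev_cat_rev γ t).symm

@[simp] theorem contractRev_one (γ : loop Z) : contractRev γ 1 = (loop Z).pt := by
  ext t
  exact (congrArg (ev γ) (mix_one _ _)).trans (ev_zero γ)

@[simp] theorem contractRev_pt (u : I) : contractRev (loop Z).pt u = (loop Z).pt := by
  ext t
  rfl

@[fun_prop] theorem continuous_contractRev {P : Type*} [TopologicalSpace P] {g : P → loop Z}
    {h : P → I} (hg : Continuous g) (hh : Continuous h) :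
    Continuous fun p => contractRev (g p) (h p) := by
  rw [continuous_loop_iff]
  change Continuous fun p : P × I => ev (g p.1) (mix (h p.1) (tent p.2) 0)
  fun_prop

namespace PMap

/-- The pointwise concatenation. -/
noncomputable def mul (f g : PMap K (loop Z)) : PMap K (loop Z) where
  toFun k := cat (f k) (g k)
  cont := by
    have := f.cont
    have := g.cont
    fun_prop
  map_pt := by simp

/-- The pointwise reverse. -/
def inv (f : PMap K (loop Z)) : PMap K (loop Z) where
  toFun k := rev (f k)
  cont := by
    have := f.cont
    fun_prop
  map_pt := by simp

@[simp] theorem mul_apply (f g : PMap K (loop Z)) (k : K) : f.mul g k = cat (f k) (g k) := rfl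
@[simp] theorem inv_apply (f : PMap K (loop Z)) (k : K) : f.inv k = rev (f k) := rfl

theorem Homotopic.mul {f f' g g' : PMap K (loop Z)} (h : f.Homotopic f') (h' : g.Homotopic g') :
    (f.mul g).Homotopic (f'.mul g') := by
  obtain ⟨H, hc, h0, h1, hp⟩ := homotopic_iff.1 h
  obtain ⟨H', kc, k0, k1, kp⟩ := homotopic_iff.1 h'
  exact homotopic_iff.2 ⟨fun p => cat (H p) (H' p), by fun_prop, by simp [h0, k0],
    by simp [h1, k1], by simp [hp, kp]⟩

theorem Homotopic.inv {f f' : PMap K (loop Z)} (h : f.Homotopic f') :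
    f.inv.Homotopic f'.inv := by
  obtain ⟨H, hc, h0, h1, hp⟩ := homotopic_iff.1 h
  exact homotopic_iff.2 ⟨fun p => rev (H p), by fun_prop, by simp [h0], by simp [h1], by simp [hp]⟩

/-- Reparametrizing loops does not change the homotopy class. -/
theorem homotopic_of_reparam {f g : PMap K (loop Z)} (ρ : I → I) (hρ : Continuous ρ)
    (h0 : ρ 0 = 0) (h1 : ρ 1 = 1) (h : ∀ k t, ev (g k) t = ev (f k) (ρ t)) : f.Homotopic g := by
  have := f.cont
  -- The straight-line homotopy from the identity of `I` to `ρ` fixes both endpoints, so every stage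
  -- is a based loop.
  refine homotopic_iff.2 ⟨fun p => mkLoop (fun t => ev (f p.1) (mix p.2 t (ρ t))) (by fun_prop)
    (by simp [h0]) (by simp [h1]), ?_, ?_, ?_, ?_⟩
  · rw [continuous_loop_iff]
    change Continuous fun p : (K × I) × I => ev (f p.1.1) (mix p.1.2 p.2 (ρ p.2))
    fun_prop
  · intro k
    ext t
    exact congrArg (ev (f k)) (mix_zero _ _)
  · intro k
    ext t
    exact (congrArg (ev (f k)) (mix_one _ _)).trans (h k t).symm
  · intro s
    ext t
    change ev (f K.pt) _ = _
    rw [apply_pt]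
    rfl

theorem mul_assoc_homotopic (f g h : PMap K (loop Z)) :
    ((f.mul g).mul h).Homotopic (f.mul (g.mul h)) := by
  refine (homotopic_of_reparam (fun t => ⟨Path.Homotopy.transAssocReparamAux t,
      Path.Homotopy.transAssocReparamAux_mem_I t⟩) (by fun_prop)
    (Subtype.ext Path.Homotopy.transAssocReparamAux_zero)
    (Subtype.ext Path.Homotopy.transAssocReparamAux_one) fun k t => ?_).symm
  exact congrArg (fun γ : Path Z.pt Z.pt => γ t) (Path.Homotopy.trans_assoc_reparam _ _ _)

theorem mul_const_homotopic (f : PMap K (loop Z)) : (f.mul (const _ _)).Homotopic f := by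
  refine (homotopic_of_reparam (fun t => ⟨Path.Homotopy.transReflReparamAux t,
      Path.Homotopy.transReflReparamAux_mem_I t⟩) (by fun_prop)
    (Subtype.ext Path.Homotopy.transReflReparamAux_zero)
    (Subtype.ext Path.Homotopy.transReflReparamAux_one) fun k t => ?_).symm
  exact congrArg (fun γ : Path Z.pt Z.pt => γ t) (Path.Homotopy.trans_refl_reparam _)

theorem mul_inv_homotopic (f : PMap K (loop Z)) : (f.mul f.inv).Homotopic (const _ _) := by
  have := f.cont
  exact homotopic_iff.2 ⟨fun p => contractRev (f p.1) p.2, by fun_prop, by simp, by simp, by simp⟩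

end PMap

/-! ### The group of homotopy classes of maps into a loop space -/

/-- The homotopy relation as a setoid. -/
def homotopySetoid (K Z : PtdSpace.{u}) : Setoid (PMap K Z) :=
  ⟨PMap.Homotopic, .refl, .symm, .trans⟩

/-- Homotopy classes of maps into a loop space. -/
def LoopClass (K Z : PtdSpace.{u}) : Type u := Quotient (homotopySetoid K (loop Z))

/-- The class of a map. -/
def cls (f : PMap K (loop Z)) : LoopClass K Z := Quotient.mk _ f

theorem cls_eq_iff {f g : PMap K (loop Z)} : cls f = cls g ↔ f.Homotopic g := Quotient.eq

noncomputable instance : Mul (LoopClass K Z) :=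
  ⟨Quotient.map₂ PMap.mul fun _ _ h _ _ h' => h.mul h'⟩

instance : Inv (LoopClass K Z) := ⟨Quotient.map PMap.inv fun _ _ h => h.inv⟩

instance : One (LoopClass K Z) := ⟨cls (const _ _)⟩

noncomputable instance : Group (LoopClass K Z) :=
  Group.ofRightAxioms
    (by
      rintro ⟨f⟩ ⟨g⟩ ⟨h⟩
      exact cls_eq_iff.2 (mul_assoc_homotopic f g h))
    (by
      rintro ⟨f⟩
      exact cls_eq_iff.2 (mul_const_homotopic f))
    (by
      rintro ⟨f⟩
      exact cls_eq_iff.2 (mul_inv_homotopic f))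

theorem cls_mul (f g : PMap K (loop Z)) : cls (f.mul g) = cls f * cls g := rfl
theorem cls_inv (f : PMap K (loop Z)) : cls f.inv = (cls f)⁻¹ := rfl
theorem cls_const : cls (const K (loop Z)) = 1 := rfl

/-! ### The loop-suspension adjunction -/

/-- Functoriality of the loop space. -/
def PMap.loop (g : PMap Z W) : PMap (loop Z) (loop W) where
  toFun γ := mkLoop (fun t => g (ev γ t)) (by have := g.cont; fun_prop) (by simp) (by simp)
  cont := by
    rw [continuous_loop_iff]
    have := g.cont
    change Continuous fun p : PtdSpace.loop Z × I => g (ev p.1 p.2)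
    fun_prop
  map_pt := by
    ext t
    exact g.map_pt

@[simp] theorem ev_loop (g : PMap Z W) (γ : loop Z) (t : I) : ev (g.loop γ) t = g (ev γ t) := rfl

theorem loop_cat (g : PMap Z W) (a b : loop Z) : g.loop (cat a b) = cat (g.loop a) (g.loop b) := by
  ext t
  change g (Path.trans _ _ t) = Path.trans _ _ t
  rw [Path.trans_apply, Path.trans_apply]
  split_ifs <;> rfl

theorem loop_mul (g : PMap Z W) (a b : PMap K (loop Z)) :
    g.loop.comp (a.mul b) = (g.loop.comp a).mul (g.loop.comp b) :=
  PMap.ext fun _ => loop_cat _ _ _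

theorem loop_inv (g : PMap Z W) (a : PMap K (loop Z)) :
    g.loop.comp a.inv = (g.loop.comp a).inv := rfl

/-- The map out of the suspension that corresponds to a map into the loop space. -/
def adj (f : PMap K (loop Z)) : PMap K.susp Z :=
  suspLift (fun p => ev (f p.1) p.2) (by have := f.cont; fun_prop) (by
    rintro ⟨x, t⟩ (h | h | h) <;> simp at h <;> subst h <;> simp)

@[simp] theorem adj_mk (f : PMap K (loop Z)) (p : K × I) : adj f (suspMk K p) = ev (f p.1) p.2 :=
  rfl

/-- The unit of the loop-suspension adjunction. -/
def eta (K : PtdSpace.{u}) : PMap K (loop K.susp) where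
  toFun k := mkLoop (fun t => suspMk K (k, t)) (by fun_prop) (by simp) (by simp)
  cont := by
    rw [continuous_loop_iff]
    exact continuous_suspMk
  map_pt := by
    ext t
    exact suspMk_pt t

@[simp] theorem ev_eta (k : K) (t : I) : ev (eta K k) t = suspMk K (k, t) := rfl

theorem adj_homotopic {f g : PMap K (loop Z)} (h : f.Homotopic g) : (adj f).Homotopic (adj g) := by
  obtain ⟨H, hc, h0, h1, hp⟩ := homotopic_iff.1 h
  let G : K.susp × I → Z := fun q => adj ⟨fun k => (H (k, q.2)), by fun_prop, hp _⟩ q.1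
  have hG : ∀ p t, G (suspMk K p, t) = ev (H (p.1, t)) p.2 := fun _ _ => rfl
  refine homotopic_iff.2 ⟨G, ?_, ?_, ?_, ?_⟩
  · refine isQuotientMap_suspMk.continuous_lift_prod_left ?_
    simp only [hG]
    fun_prop
  · intro x
    obtain ⟨p, rfl⟩ := suspMk_surjective x
    simp [hG, h0]
  · intro x
    obtain ⟨p, rfl⟩ := suspMk_surjective x
    simp [hG, h1]
  · intro t
    exact PMap.map_pt _

theorem adj_loop_eta (g : PMap K.susp Z) : adj (g.loop.comp (eta K)) = g := by
  ext x
  obtain ⟨p, rfl⟩ := suspMk_surjective x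
  rfl

/-- This transfers homotopies between maps out of a suspension to the group `LoopClass K Z`, where
they can be calculated. -/
theorem homotopic_of_loop_eta {f g : PMap K.susp Z}
    (h : (f.loop.comp (eta K)).Homotopic (g.loop.comp (eta K))) : f.Homotopic g := by
  rw [← adj_loop_eta f, ← adj_loop_eta g]
  exact adj_homotopic h

theorem loop_adj_eta (f : PMap K (loop Z)) : (adj f).loop.comp (eta K) = f := by
  ext k t
  rfl

theorem loop_comp (g : PMap Z W) (f : PMap X Z) : (g.comp f).loop = g.loop.comp f.loop := by
  ext γ t
  rfl

/-! ### Splitting of the suspension -/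

/-- The homotopy extension property of a subset. -/
def HEP (T : Type u) [TopologicalSpace T] (S : Set T) : Prop :=
  ∀ (W : Type u) [TopologicalSpace W] (f : T → W) (h : T × I → W), Continuous f → Continuous h →
    (∀ y ∈ S, h (y, 0) = f y) → ∃ F : T × I → W, Continuous F ∧ (∀ y, F (y, 0) = f y) ∧
      ∀ y ∈ S, ∀ s, F (y, s) = h (y, s)

/-- A retract with the homotopy extension property, and the quotient that it has. -/
structure CofibreSplit (B T Q : PtdSpace.{u}) where
  /-- The inclusion. -/
  j : PMap B T
  /-- The retraction. -/
  p : PMap T B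
  /-- The quotient map. -/
  q : PMap T Q
  p_j : ∀ b, p (j b) = b
  q_j : ∀ b, q (j b) = Q.pt
  isQuotientMap : IsQuotientMap q
  fibre : ∀ y y', q y = q y' → y = y' ∨ (y ∈ Set.range j ∧ y' ∈ Set.range j)
  hep : HEP T (Set.range j)

namespace CofibreSplit

variable (D : CofibreSplit B T Q)

theorem exists_descend {V : Type*} [TopologicalSpace V] (g : T → V) (hg : Continuous g)
    (v : V) (hv : ∀ b, g (D.j b) = v) : ∃ d : Q → V, Continuous d ∧ ∀ y, d (D.q y) = g y := by
  have hd : ∀ y, g (Function.surjInv D.isQuotientMap.surjective (D.q y)) = g y := by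
    intro y
    rcases D.fibre _ _ (Function.surjInv_eq D.isQuotientMap.surjective (D.q y)) with h | ⟨h, h'⟩
    · rw [h]
    · obtain ⟨b, hb⟩ := h
      obtain ⟨b', hb'⟩ := h'
      rw [← hb, ← hb', hv, hv]
  refine ⟨fun x => g (Function.surjInv D.isQuotientMap.surjective x), ?_, hd⟩
  rw [D.isQuotientMap.continuous_iff]
  exact hg.congr fun y => (hd y).symm

/-- Currying turns a homotopy into a single map to `C(I, V)`, to which `exists_descend` applies. -/
theorem exists_homotopy_descend {V : Type*} [TopologicalSpace V] (g : T × I → V)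
    (hg : Continuous g) (v : V) (hv : ∀ b t, g (D.j b, t) = v) :
    ∃ d : Q × I → V, Continuous d ∧ ∀ y t, d (D.q y, t) = g (y, t) := by
  obtain ⟨d, hd, h⟩ := D.exists_descend (ContinuousMap.curry ⟨g, hg⟩) (ContinuousMap.continuous _)
    (.const I v) fun b => by
      ext t
      exact hv b t
  refine ⟨fun p => d p.1 p.2, by fun_prop, fun y t => ?_⟩
  change d (D.q y) t = _
  rw [h]
  rfl

/-- The null homotopy on `B` extends to a homotopy of `α`, whose end is constant on `B` and hence
factors through `Q`. The retraction `p` supplies the map on all of `T × I` that `HEP` asks for. -/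
theorem exists_factor (α : PMap T Z) (h : (α.comp D.j).Homotopic (const _ _)) :
    ∃ δ : PMap Q Z, (δ.comp D.q).Homotopic α := by
  obtain ⟨N, hN, n0, n1, np⟩ := homotopic_iff.1 h
  have hp := D.p.cont
  obtain ⟨F, hF, f0, fj⟩ := D.hep Z α (fun x => N (D.p x.1, x.2)) α.cont (by fun_prop) (by
    rintro _ ⟨b, rfl⟩
    simp [D.p_j, n0])
  replace fj : ∀ b s, F (D.j b, s) = N (b, s) := fun b s => by
    rw [fj _ ⟨b, rfl⟩, D.p_j]
  obtain ⟨d, hd, hdq⟩ := D.exists_descend (fun y => F (y, 1)) (by fun_prop) Z.pt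
    (by simp [fj, n1])
  refine ⟨⟨d, hd, ?_⟩, ?_⟩
  · rw [← D.q.map_pt, hdq, ← D.j.map_pt, fj, n1]
    rfl
  · refine (homotopic_iff.2 ⟨F, hF, f0, fun x => (hdq x).symm, fun t => ?_⟩).symm
    rw [← D.j.map_pt, fj, np]

/-- A null homotopy `H` of `c ∘ q` need not be constant on `B`, but there it is a family of closed
paths in the loop space. Multiplying `H` by the inverse of its restriction to `B`, pulled back along
`p`, makes it null on `B`, and after a deformation it descends to `Q`. This is the point where the
retraction makes `q` injective on homotopy classes. -/
theorem homotopic_const_of_comp (c : PMap Q (loop Z)) (h : (c.comp D.q).Homotopic (const _ _)) :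
    c.Homotopic (const _ _) := by
  obtain ⟨H, hH, h0, h1, hp⟩ := homotopic_iff.1 h
  have cp := D.p.cont
  have cj := D.j.cont
  -- With values in the path space `C(I, loop Z)`, the extension property deforms the whole
  -- corrected homotopy at once: `u` is the deformation parameter and `s` the time of `H`. On `B`
  -- the corrected homotopy is γ γ⁻¹, which `contractRev` contracts.
  obtain ⟨F, hF, f0, fj⟩ := D.hep C(I, loop Z)
    (fun y => ⟨fun s => cat (H (y, s)) (rev (H (D.j (D.p y), s))), by fun_prop⟩)
    (fun x => ⟨fun s => contractRev (H (x.1, s)) x.2, by fun_prop⟩)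
    (ContinuousMap.continuous_of_continuous_uncurry _ (by
      change Continuous fun p : T × I => cat (H (p.1, p.2)) (rev (H (D.j (D.p p.1), p.2)))
      fun_prop))
    (ContinuousMap.continuous_of_continuous_uncurry _ (by
      change Continuous fun p : (T × I) × I => contractRev (H (p.1.1, p.2)) p.1.2
      fun_prop))
    (by
      rintro _ ⟨b, rfl⟩
      ext1 s
      simp [D.p_j])
  replace f0 : ∀ y s, F (y, 0) s = cat (H (y, s)) (rev (H (D.j (D.p y), s))) := fun y s => by
    rw [f0]
    rfl
  replace fj : ∀ b u s, F (D.j b, u) s = contractRev (H (D.j b, s)) u := fun b u s => by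
    rw [fj _ ⟨b, rfl⟩]
    rfl
  have hj0 : ∀ b, H (D.j b, 0) = (loop Z).pt := fun b => by rw [h0]; simp [D.q_j]
  have hj1 : ∀ b, H (D.j b, 1) = (loop Z).pt := fun b => by rw [h1]; rfl
  obtain ⟨d0, cd0, hd0⟩ := D.exists_homotopy_descend (fun x => F (x.1, x.2) 0) (by fun_prop)
    (loop Z).pt (by simp [fj, hj0])
  obtain ⟨d1, cd1, hd1⟩ := D.exists_homotopy_descend (fun x => F (x.1, x.2) 1) (by fun_prop)
    (loop Z).pt (by simp [fj, hj1])
  obtain ⟨e, ce, he⟩ := D.exists_homotopy_descend (fun x => F (x.1, 1) x.2) (by fun_prop)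
    (loop Z).pt (by simp [fj])
  have q0 : Q.pt = D.q (D.j B.pt) := by simp
  have pd0 : ∀ t, d0 (Q.pt, t) = (loop Z).pt := fun t => by rw [q0, hd0, fj, hj0]; simp
  have pd1 : ∀ t, d1 (Q.pt, t) = (loop Z).pt := fun t => by rw [q0, hd1, fj, hj1]; simp
  have pe : ∀ t, e (Q.pt, t) = (loop Z).pt := fun t => by rw [q0, he, fj]; simp
  -- Three sides of the square in `(u, s)` descend to `Q`: `s = 0` leads from `c · const` to `m0`,
  -- `u = 1` from `m0` to `m1`, and `s = 1` from the constant map to `m1`.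
  let m0 : PMap Q (loop Z) := ⟨fun x => e (x, 0), by fun_prop, pe 0⟩
  let m1 : PMap Q (loop Z) := ⟨fun x => e (x, 1), by fun_prop, pe 1⟩
  have a1 : (c.mul (const _ _)).Homotopic m0 := by
    refine homotopic_iff.2 ⟨d0, cd0, fun x => ?_, fun x => ?_, pd0⟩ <;>
      obtain ⟨y, rfl⟩ := D.isQuotientMap.surjective x
    · rw [hd0, f0, hj0, h0]
      simp
    · exact (hd0 y 1).trans (he y 0).symm
  have a2 : m0.Homotopic m1 := homotopic_iff.2 ⟨e, ce, fun _ => rfl, fun _ => rfl, pe⟩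
  have a3 : (const Q (loop Z)).Homotopic m1 := by
    refine homotopic_iff.2 ⟨d1, cd1, fun x => ?_, fun x => ?_, pd1⟩ <;>
      obtain ⟨y, rfl⟩ := D.isQuotientMap.surjective x
    · rw [hd1, f0, hj1, h1]
      simp
    · exact (hd1 y 1).trans (he y 1).symm
  exact (mul_const_homotopic c).symm.trans (a1.trans (a2.trans a3.symm))

/-- Composition with `q` is a homomorphism of groups, so a trivial kernel gives injectivity. -/
theorem homotopic_of_comp {c c' : PMap Q (loop Z)} (h : (c.comp D.q).Homotopic (c'.comp D.q)) :
    c.Homotopic c' := by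
  have h1 : ((c.mul c'.inv).comp D.q).Homotopic (const _ _) := by
    change ((c.comp D.q).mul (c'.comp D.q).inv).Homotopic (const _ _)
    rw [← cls_eq_iff, cls_mul, cls_inv, cls_eq_iff.2 h, mul_inv_cancel, cls_const]
  have h2 := D.homotopic_const_of_comp _ h1
  rwa [← cls_eq_iff, cls_mul, cls_inv, cls_const, mul_inv_eq_one, cls_eq_iff] at h2

/-- The suspension of a space splits over a retract that has the homotopy extension property. -/
theorem susp_homotopyEquivalent (D : CofibreSplit B T Q) [T2Space B] [T2Space Q] :
    HomotopyEquivalent T.susp (wedge B.susp Q.susp) := by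
  -- `e` is the part of `eta T` that comes from `B`. The quotient `eta · e⁻¹` is null on `B`, so up
  -- to homotopy it factors through `Q`, as `δ`.
  let e : PMap T (loop T.susp) := (eta T).comp (D.j.comp D.p)
  obtain ⟨δ, hδ⟩ := D.exists_factor ((eta T).mul e.inv) (by
    have : e.comp D.j = (eta T).comp D.j := by
      ext b t
      simp [e, D.p_j]
    change (((eta T).comp D.j).mul (e.comp D.j).inv).Homotopic (const _ _)
    rw [this]
    exact mul_inv_homotopic _)
  rw [← cls_eq_iff, cls_mul, cls_inv] at hδ
  let iQ : PMap Q (loop (wedge B.susp Q.susp)) := (wedgeInr _ _).loop.comp (eta Q)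
  let iB : PMap B (loop (wedge B.susp Q.susp)) := (wedgeInl _ _).loop.comp (eta B)
  -- The order of the factors matters, as these groups need not be commutative: it matches `δ q ≃
  -- eta · e⁻¹`, so that `ψ` takes `φ'` to `(eta · e⁻¹) · e = eta`.
  let φ' : PMap T (loop (wedge B.susp Q.susp)) := (iQ.comp D.q).mul (iB.comp D.p)
  let ψ : PMap (wedge B.susp Q.susp) T.susp := wedgeDesc D.j.susp (adj δ)
  have ψr : ψ.loop.comp iQ = δ := by
    ext k t
    change ψ (wedgeInr _ _ (suspMk Q (k, t))) = _
    rw [wedgeDesc_inr]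
    rfl
  have ψl : ψ.loop.comp iB = (eta T).comp D.j := by
    ext k t
    change ψ (wedgeInl _ _ (suspMk B (k, t))) = _
    rw [wedgeDesc_inl]
    rfl
  have φj : φ'.comp D.j = (const _ _).mul iB := by
    ext1 b
    simp [φ', D.p_j, D.q_j]
  have hφj : (φ'.comp D.j).Homotopic iB := by
    rw [φj, ← cls_eq_iff, cls_mul, cls_const, one_mul]
  refine homotopyEquivalent_iff.2 ⟨adj φ', ψ, ?_, ?_⟩
  · refine homotopic_of_loop_eta ?_
    rw [loop_comp]
    change (ψ.loop.comp ((adj φ').loop.comp (eta T))).Homotopic _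
    rw [loop_adj_eta, loop_mul]
    change ((((ψ.loop.comp iQ).comp D.q).mul ((ψ.loop.comp iB).comp D.p))).Homotopic (eta T)
    rw [ψr, ψl, ← cls_eq_iff, cls_mul, hδ]
    exact inv_mul_cancel_right (cls (eta T)) (cls e)
  · refine .of_wedge ?_ ?_
    · refine homotopic_of_loop_eta ?_
      refine (Homotopic.of_eq ?_).trans hφj
      ext b t
      change adj φ' (ψ (wedgeInl _ _ (suspMk B (b, t)))) = _
      rw [wedgeDesc_inl]
      rfl
    · refine homotopic_of_loop_eta ?_
      have h1 : (((adj φ').comp ψ).comp (wedgeInr _ _)).loop.comp (eta Q) =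
          (adj φ').loop.comp δ := by
        ext b t
        change adj φ' (ψ (wedgeInr _ _ (suspMk Q (b, t)))) = _
        rw [wedgeDesc_inr]
        rfl
      rw [h1]
      -- After composition with `q`, `δ` becomes `eta · e⁻¹`, and its image is `φ' · (φ' j p)⁻¹ =
      -- (iQ q · iB p) · (iB p)⁻¹ = iQ q`.
      refine D.homotopic_of_comp (c' := iQ) ?_
      have h2 : (((adj φ').loop.comp δ).comp D.q).Homotopic
          ((adj φ').loop.comp ((eta T).mul e.inv)) := by
        rw [← cls_inv, ← cls_mul, cls_eq_iff] at hδ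
        exact hδ.comp_left (adj φ').loop
      refine h2.trans ?_
      rw [loop_mul, loop_inv, loop_adj_eta]
      have h3 : (adj φ').loop.comp e = (φ'.comp D.j).comp D.p := by
        ext y t
        rfl
      rw [h3, ← cls_eq_iff, cls_mul, cls_inv, cls_eq_iff.2 (hφj.comp_right D.p)]
      exact mul_inv_cancel_right (cls (iQ.comp D.q)) (cls (iB.comp D.p))

end CofibreSplit

end PtdSpace

namespace PtdSpace

open Topology unitInterval

/-! ### Cell structures -/

/-- The closed unit cube. -/
abbrev Cube (n : ℕ) : Set (Fin n → ℝ) := {v | ‖v‖ ≤ 1}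

theorem cube_eq (n : ℕ) : Cube n = Metric.closedBall 0 1 := by
  ext v
  simp

theorem isCompact_cube (n : ℕ) : IsCompact (Cube n) := by
  rw [cube_eq]
  exact isCompact_closedBall _ _

theorem isClosed_cube (n : ℕ) : IsClosed (Cube n) := (isCompact_cube n).isClosed

/-- A CW structure, given by characteristic maps on closed cubes. -/
structure CellStructure (Z : Type u) [TopologicalSpace Z] where
  /-- The cells. -/
  ι : Type u
  /-- The dimension of a cell. -/
  dim : ι → ℕ
  /-- The characteristic map of a cell. -/
  map : ∀ i, (Fin (dim i) → ℝ) → Z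
  continuousOn : ∀ i, ContinuousOn (map i) (Cube (dim i))
  cover : ∀ z, ∃ s : Σ i, (Fin (dim i) → ℝ), ‖s.2‖ < 1 ∧ map s.1 s.2 = z
  disj : ∀ i j v w, ‖v‖ < 1 → ‖w‖ < 1 → map i v = map j w → i = j
  inj : ∀ i v w, ‖v‖ < 1 → ‖w‖ < 1 → map i v = map i w → v = w
  boundary : ∀ i, ∃ F : Set ι, F.Finite ∧ ∀ v, ‖v‖ = 1 →
    ∃ j ∈ F, dim j < dim i ∧ ∃ w, ‖w‖ < 1 ∧ map j w = map i v
  isClosed_of : ∀ A : Set Z, (∀ i, IsClosed (Cube (dim i) ∩ map i ⁻¹' A)) → IsClosed A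

/-- If `g` is continuous after pulling back to finitely many compact sets, then it is continuous
on their images. -/
theorem continuousOn_biUnion_image {ι Z W : Type*} {E : ι → Type*} [TopologicalSpace Z] [T2Space Z]
    [TopologicalSpace W] [∀ i, TopologicalSpace (E i)] [∀ i, T2Space (E i)] {F : Set ι}
    (hF : F.Finite) {K : ∀ i, Set (E i)} (hK : ∀ i, IsCompact (K i)) {φ : ∀ i, E i → Z}
    (hφ : ∀ i, ContinuousOn (φ i) (K i)) {g : Z → W}
    (hg : ∀ i ∈ F, ContinuousOn (fun x => g (φ i x)) (K i)) :
    ContinuousOn g (⋃ i ∈ F, φ i '' K i) := by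
  rw [continuousOn_iff_isClosed]
  intro t ht
  refine ⟨⋃ i ∈ F, φ i '' (K i ∩ (fun x => g (φ i x)) ⁻¹' t), hF.isClosed_biUnion fun i hi => ?_, ?_⟩
  · have h1 := (hg i hi).preimage_isClosed_of_isClosed (hK i).isClosed ht
    exact ((((hK i).of_isClosed_subset h1 Set.inter_subset_left)).image_of_continuousOn
      ((hφ i).mono Set.inter_subset_left)).isClosed
  · ext z
    simp only [Set.mem_inter_iff, Set.mem_preimage, Set.mem_iUnion, Set.mem_image, exists_prop]
    constructor
    · rintro ⟨hz, i, hi, x, hx, rfl⟩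
      exact ⟨⟨i, hi, x, ⟨hx, hz⟩, rfl⟩, i, hi, x, hx, rfl⟩
    · rintro ⟨⟨i, hi, x, ⟨hx, hz⟩, rfl⟩, h⟩
      exact ⟨hz, h⟩

namespace CellStructure

variable {Z : Type u} [TopologicalSpace Z] (S : CellStructure Z)

/-- The weak topology only controls maps out of `Z`, so `g` is curried to `Z → C(P, W)`; uncurrying
at the end needs `P` locally compact. -/
theorem continuous_prod {P W : Type*} [TopologicalSpace P] [LocallyCompactSpace P]
    [TopologicalSpace W] {g : Z × P → W}
    (hg : ∀ i, ContinuousOn (fun p : (Fin (S.dim i) → ℝ) × P => g (S.map i p.1, p.2))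
      (Cube _ ×ˢ Set.univ)) : Continuous g := by
  have hg' : ∀ i, Continuous fun p : Cube (S.dim i) × P => g (S.map i p.1, p.2) := fun i =>
    (hg i).comp_continuous (f := fun p : Cube (S.dim i) × P => ((p.1 : Fin (S.dim i) → ℝ), p.2))
      (by fun_prop) fun p => ⟨p.1.2, trivial⟩
  have hs : ∀ z, Continuous fun p => g (z, p) := by
    intro z
    obtain ⟨⟨i, v⟩, hv, rfl⟩ := S.cover z
    exact (hg' i).comp (Continuous.prodMk_right (⟨v, hv.le⟩ : Cube (S.dim i)))
  let G : Z → C(P, W) := fun z => ⟨_, hs z⟩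
  have hG : Continuous G := by
    rw [continuous_iff_isClosed]
    intro C hC
    refine S.isClosed_of _ fun i => ?_
    have : Continuous fun v : Cube (S.dim i) => G (S.map i v) :=
      ContinuousMap.continuous_of_continuous_uncurry _ (hg' i)
    rw [← Set.preimage_comp]
    exact (continuousOn_iff_continuous_domRestrict.2 this).preimage_isClosed_of_isClosed
      (isClosed_cube _) hC
  exact ContinuousMap.continuous_uncurry_of_continuous ⟨G, hG⟩

theorem continuous_of {W : Type*} [TopologicalSpace W] {g : Z → W}
    (hg : ∀ i, ContinuousOn (fun v => g (S.map i v)) (Cube (S.dim i))) : Continuous g := by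
  have := S.continuous_prod (P := Unit) (g := fun p => g p.1) fun i =>
    (hg i).comp continuousOn_fst fun _ hp => hp.1
  exact this.comp (Continuous.prodMk_left ())

/-- The cell and the coordinates of a point. -/
noncomputable def coord (z : Z) : Σ i, (Fin (S.dim i) → ℝ) := (S.cover z).choose

theorem norm_coord (z : Z) : ‖(S.coord z).2‖ < 1 := (S.cover z).choose_spec.1

theorem map_coord (z : Z) : S.map (S.coord z).1 (S.coord z).2 = z := (S.cover z).choose_spec.2

theorem coord_map (i : S.ι) (v) (hv : ‖v‖ < 1) : S.coord (S.map i v) = ⟨i, v⟩ := by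
  have h1 := S.norm_coord (S.map i v)
  have h2 := S.map_coord (S.map i v)
  generalize S.coord (S.map i v) = s at *
  obtain ⟨j, w⟩ := s
  obtain rfl : j = i := S.disj _ _ _ _ h1 hv h2
  exact congrArg (Sigma.mk j) (S.inj j w v h1 hv h2)

theorem exists_boundary_le (i : S.ι) :
    ∃ F : Set S.ι, F.Finite ∧ ∀ v, ‖v‖ ≤ 1 → ∃ j ∈ F, S.dim j ≤ S.dim i ∧
      (‖v‖ = 1 → S.dim j < S.dim i) ∧ ∃ w, ‖w‖ < 1 ∧ S.map j w = S.map i v := by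
  obtain ⟨F, hF, hb⟩ := S.boundary i
  refine ⟨insert i F, hF.insert i, fun v hv => ?_⟩
  rcases lt_or_eq_of_le hv with hv | hv
  · exact ⟨i, Or.inl rfl, le_rfl, fun h => absurd h hv.ne, v, hv, rfl⟩
  · obtain ⟨j, hj, hji, hw⟩ := hb v hv
    exact ⟨j, Or.inr hj, hji.le, fun _ => hji, hw⟩

/-! ### The homotopy extension property -/

/-- The denominator in the retraction of the cylinder over a cube. -/
noncomputable def cylDenom {n : ℕ} (p : (Fin n → ℝ) × I) : ℝ := max (2 * ‖p.1‖) (2 - p.2)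

theorem cylDenom_pos {n : ℕ} (p : (Fin n → ℝ) × I) : 0 < cylDenom p :=
  lt_of_lt_of_le (by linarith [p.2.2.2]) (le_max_right _ _)

/-- The retraction of the cylinder over a cube onto the union of its bottom and its sides. -/
noncomputable def cylRetract {n : ℕ} (p : (Fin n → ℝ) × I) : (Fin n → ℝ) × I :=
  -- Radial projection from the point `(0, 2)` above the cylinder. The maximum in `cylDenom` decides
  -- whether the ray meets the side or the bottom; the clamping by `projIcc` changes nothing for
  -- `‖p.1‖ ≤ 1`.
  ((2 / cylDenom p) • p.1, Set.projIcc 0 1 zero_le_one (2 - 2 * (2 - p.2) / cylDenom p))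

theorem continuous_cylRetract {n : ℕ} : Continuous (cylRetract (n := n)) := by
  have h : Continuous (cylDenom (n := n)) := by
    unfold cylDenom
    fun_prop
  have h0 : ∀ p, cylDenom (n := n) p ≠ 0 := fun p => (cylDenom_pos p).ne'
  unfold cylRetract
  refine Continuous.prodMk ?_ (continuous_projIcc.comp ?_)
  · exact (continuous_const.div h h0).smul continuous_fst
  · exact continuous_const.sub ((by fun_prop : Continuous fun p : (Fin n → ℝ) × I =>
      2 * (2 - (p.2 : ℝ))).div h h0)

theorem cylRetract_of_zero {n : ℕ} (v : Fin n → ℝ) (hv : ‖v‖ ≤ 1) : cylRetract (v, 0) = (v, 0) := by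
  have : cylDenom (v, (0 : I)) = 2 := by
    simp only [cylDenom, Set.Icc.coe_zero, sub_zero]
    exact max_eq_right (by linarith)
  simp [cylRetract, this]

theorem cylRetract_of_norm {n : ℕ} (v : Fin n → ℝ) (hv : ‖v‖ = 1) (t : I) :
    cylRetract (v, t) = (v, t) := by
  have : cylDenom (v, t) = 2 := by
    simp only [cylDenom, hv]
    exact (max_eq_left (by linarith [t.2.1])).trans (mul_one _)
  simp only [cylRetract, this]
  refine Prod.ext (by simp) ?_
  simp only
  have : (2 : ℝ) - 2 * (2 - t) / 2 = t := by ring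
  rw [this]
  exact Set.projIcc_val _ t

theorem cylRetract_mem {n : ℕ} (p : (Fin n → ℝ) × I) :
    ‖(cylRetract p).1‖ ≤ 1 ∧ ((cylRetract p).2 = 0 ∨ ‖(cylRetract p).1‖ = 1) := by
  have h0 := cylDenom_pos p
  have h1 : 2 * ‖p.1‖ ≤ cylDenom p := le_max_left _ _
  have hn : ‖(cylRetract p).1‖ = 2 * ‖p.1‖ / cylDenom p := by
    simp only [cylRetract, norm_smul, norm_div, Real.norm_eq_abs, abs_of_pos h0]
    norm_num
    ring
  rw [hn]
  refine ⟨(div_le_one h0).2 h1, ?_⟩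
  rcases max_choice (2 * ‖p.1‖) (2 - (p.2 : ℝ)) with h | h
  · right
    rw [show cylDenom p = 2 * ‖p.1‖ from h] at h0 ⊢
    exact div_self h0.ne'
  · left
    simp only [cylRetract]
    rw [show cylDenom p = 2 - (p.2 : ℝ) from h] at h0 ⊢
    rw [mul_div_assoc, div_self h0.ne']
    refine Set.projIcc_of_le_left _ (by norm_num)

open Classical in
/-- The extension of a homotopy from a subcomplex, by recursion over the cells. -/
noncomputable def extend {W : Type*} (R : Set Z) (f : Z → W) (h : Z × I → W) (z : Z) (t : I) : W :=
  if z ∈ R then h (z, t) else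
  let p := cylRetract ((S.coord z).2, t)
  if p.2 = 0 then f (S.map (S.coord z).1 p.1) else
  -- This test makes the recursion terminate. It succeeds for points on the side of the cylinder,
  -- which lie over the boundary of the cell, so the last branch is a default that never matters.
  if S.dim (S.coord (S.map (S.coord z).1 p.1)).1 < S.dim (S.coord z).1 then
    extend R f h (S.map (S.coord z).1 p.1) p.2
  else f z
termination_by S.dim (S.coord z).1

variable {W : Type*} {R : Set Z} {f : Z → W} {h : Z × I → W}

theorem extend_of_mem {z : Z} (hz : z ∈ R) (t : I) : S.extend R f h z t = h (z, t) := by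
  rw [extend, if_pos hz]

theorem extend_zero (hfh : ∀ z ∈ R, h (z, 0) = f z) (z : Z) : S.extend R f h z 0 = f z := by
  by_cases hz : z ∈ R
  · rw [S.extend_of_mem hz, hfh z hz]
  · rw [extend, if_neg hz, cylRetract_of_zero _ (S.norm_coord z).le]
    simp [S.map_coord]

theorem extend_map (hfh : ∀ z ∈ R, h (z, 0) = f z) (i : S.ι) (v) (hv : ‖v‖ < 1)
    (hz : S.map i v ∉ R) (t : I) : S.extend R f h (S.map i v) t =
      S.extend R f h (S.map i (cylRetract (v, t)).1) (cylRetract (v, t)).2 := by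
  rw [extend, if_neg hz, S.coord_map i v hv]
  simp only
  split_ifs with h1 h2
  · rw [h1, S.extend_zero hfh]
  · rfl
  · exfalso
    rcases cylRetract_mem (v, t) with ⟨-, h3 | h3⟩
    · exact h1 h3
    · obtain ⟨F, -, hF⟩ := S.boundary i
      obtain ⟨j, -, hj, w, hw, hjw⟩ := hF _ h3
      rw [← hjw, S.coord_map j w hw] at h2
      exact h2 hj

/-- Induction on the dimension. Over a cell outside `R` the extension is its own restriction to the
bottom and the side, composed with `cylRetract`. The bottom carries `f`, and the side is covered by
cells of lower dimension. -/
theorem continuousOn_extend [TopologicalSpace W] [T2Space Z] (hf : Continuous f) (hh : Continuous h)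
    (hfh : ∀ z ∈ R, h (z, 0) = f z)
    (hR : ∀ i, (∀ v ∈ Cube (S.dim i), S.map i v ∈ R) ∨ ∀ v, ‖v‖ < 1 → S.map i v ∉ R) (n : ℕ) :
    ∀ i, S.dim i < n → ContinuousOn (fun p : (Fin (S.dim i) → ℝ) × I =>
      S.extend R f h (S.map i p.1) p.2) (Cube _ ×ˢ Set.univ) := by
  induction n with
  | zero => simp
  | succ n ih =>
    intro i hi
    have hc : ContinuousOn (fun p : (Fin (S.dim i) → ℝ) × I => S.map i p.1)
        (Cube _ ×ˢ Set.univ) := (S.continuousOn i).comp continuousOn_fst fun p hp => hp.1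
    rcases hR i with hR | hR
    · refine ContinuousOn.congr (f := fun p => h (S.map i p.1, p.2)) ?_ ?_
      · exact hh.comp_continuousOn (hc.prodMk continuousOn_snd)
      · intro p hp
        exact S.extend_of_mem (hR _ hp.1) _
    · let g : (Fin (S.dim i) → ℝ) × I → W := fun p => S.extend R f h (S.map i p.1) p.2
      have hcl : IsClosed (Cube (S.dim i) ×ˢ ({0} : Set I)) :=
        (isClosed_cube _).prod isClosed_singleton
      have hsp : IsClosed ({v : Fin (S.dim i) → ℝ | ‖v‖ = 1} ×ˢ (Set.univ : Set I)) :=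
        (isClosed_eq continuous_norm continuous_const).prod isClosed_univ
      have g1 : ContinuousOn g (Cube (S.dim i) ×ˢ ({0} : Set I)) := by
        refine ContinuousOn.congr (f := fun p => f (S.map i p.1)) ?_ ?_
        · exact hf.comp_continuousOn (hc.mono (Set.prod_mono_right (Set.subset_univ _)))
        · rintro ⟨v, t⟩ ⟨-, ht⟩
          simp only [Set.mem_singleton_iff] at ht
          subst ht
          exact S.extend_zero hfh _
      have g2 : ContinuousOn g ({v : Fin (S.dim i) → ℝ | ‖v‖ = 1} ×ˢ (Set.univ : Set I)) := by
        obtain ⟨F, hF, hb⟩ := S.boundary i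
        -- The boundary lies in finitely many closed cells, whose cylinders are compact, so
        -- continuity on each of them suffices.
        have key := continuousOn_biUnion_image (E := fun j => (Fin (S.dim j) → ℝ) × I)
          (hF.subset (Set.sep_subset F fun j => S.dim j < S.dim i))
          (K := fun j => Cube (S.dim j) ×ˢ Set.univ)
          (fun j => (isCompact_cube _).prod isCompact_univ)
          (φ := fun j p => (S.map j p.1, p.2))
          (fun j => ((S.continuousOn j).comp continuousOn_fst fun p hp => hp.1).prodMk
            continuousOn_snd) (g := fun p => S.extend R f h p.1 p.2)
          (fun j hj => ih j (by have := hj.2; omega))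
        refine key.comp (f := fun p : (Fin (S.dim i) → ℝ) × I => (S.map i p.1, p.2)) ?_ ?_
        · exact (hc.mono (Set.prod_mono_left fun v hv => le_of_eq hv)).prodMk continuousOn_snd
        · rintro ⟨v, t⟩ ⟨hv, -⟩
          obtain ⟨j, hj, hji, w, hw, hjw⟩ := hb v hv
          simp only [Set.mem_iUnion]
          exact ⟨j, ⟨hj, hji⟩, (w, t), ⟨hw.le, trivial⟩, by simp [hjw]⟩
      have g3 := g1.union_of_isClosed g2 hcl hsp
      have g4 : ContinuousOn (fun p => g (cylRetract p)) (Cube (S.dim i) ×ˢ Set.univ) := by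
        refine g3.comp continuous_cylRetract.continuousOn ?_
        rintro p -
        obtain ⟨h1, h2 | h2⟩ := cylRetract_mem p
        · exact Or.inl ⟨h1, h2⟩
        · exact Or.inr ⟨h2, trivial⟩
      refine g4.congr ?_
      rintro ⟨v, t⟩ ⟨hv, -⟩
      rcases lt_or_eq_of_le (show ‖v‖ ≤ 1 from hv) with hv | hv
      · exact S.extend_map hfh i v hv (hR v hv) t
      · simp only [g, cylRetract_of_norm v hv]

/-- The homotopy extension property of subcomplexes. -/
theorem hep [T2Space Z] (R : Set Z)
    (hR : ∀ i, (∀ v ∈ Cube (S.dim i), S.map i v ∈ R) ∨ ∀ v, ‖v‖ < 1 → S.map i v ∉ R) :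
    HEP Z R := by
  intro W _ f h hf hh hfh
  exact ⟨fun p => S.extend R f h p.1 p.2,
    S.continuous_prod fun i => S.continuousOn_extend hf hh hfh hR _ i (Nat.lt_succ_self _),
    S.extend_zero hfh, fun y hy s => S.extend_of_mem hy s⟩

/-! ### Comparison with `CWComplex` -/

open Classical in
/-- The characteristic map as a partial equivalence. -/
noncomputable def partialEquiv (i : S.ι) : PartialEquiv (Fin (S.dim i) → ℝ) Z :=
  Set.InjOn.toPartialEquiv (S.map i) (Metric.ball 0 1) fun v hv w hw =>
    S.inj i v w (by simpa using hv) (by simpa using hw)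

theorem partialEquiv_apply (i : S.ι) (v) : S.partialEquiv i v = S.map i v := rfl

/-- A closed part of the cube has compact, hence closed, image. Boundary points add nothing in the
open cell, since they land in cells of lower dimension. -/
theorem continuousOn_partialEquiv_symm [T2Space Z] (i : S.ι) :
    ContinuousOn (S.partialEquiv i).symm (S.partialEquiv i).target := by
  rw [continuousOn_iff_isClosed]
  intro t ht
  refine ⟨S.map i '' (Cube _ ∩ t), ?_, ?_⟩
  · exact (((isCompact_cube _).inter_right ht).image_of_continuousOn
      ((S.continuousOn i).mono Set.inter_subset_left)).isClosed
  · ext z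
    constructor
    · rintro ⟨hz, hzt⟩
      have h1 := (S.partialEquiv i).map_target hzt
      refine ⟨⟨_, ⟨?_, hz⟩, (S.partialEquiv i).right_inv hzt⟩, hzt⟩
      have h2 : (S.partialEquiv i).symm z ∈ Metric.ball 0 1 := h1
      exact (mem_ball_zero_iff.1 h2).le
    · rintro ⟨⟨v, ⟨hv, hvt⟩, rfl⟩, hzt⟩
      refine ⟨?_, hzt⟩
      obtain ⟨w, hw, hwv⟩ : S.map i v ∈ S.map i '' Metric.ball 0 1 := hzt
      rw [mem_ball_zero_iff] at hw
      rcases lt_or_eq_of_le (show ‖v‖ ≤ 1 from hv) with h1 | h1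
      · have : (S.partialEquiv i).symm (S.partialEquiv i v) = v :=
          (S.partialEquiv i).left_inv (mem_ball_zero_iff.2 h1)
        rw [partialEquiv_apply] at this
        rw [Set.mem_preimage, this]
        exact hvt
      · obtain ⟨F, -, hF⟩ := S.boundary i
        obtain ⟨j, -, hj, w', hw', hjw⟩ := hF v h1
        have := S.disj _ _ _ _ hw' hw (hjw.trans hwv.symm)
        subst this
        exact absurd hj (lt_irrefl _)

open Classical in
/-- The associated `CWComplex`. -/
@[reducible] noncomputable def toCWComplex [T2Space Z] :
    Topology.CWComplex (Set.univ : Set Z) where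
  cell n := {i : S.ι // S.dim i = n}
  map n i := i.2 ▸ S.partialEquiv i.1
  source_eq := by
    rintro _ ⟨i, rfl⟩
    rfl
  continuousOn := by
    rintro _ ⟨i, rfl⟩
    rw [← cube_eq]
    exact S.continuousOn i
  continuousOn_symm := by
    rintro _ ⟨i, rfl⟩
    exact S.continuousOn_partialEquiv_symm i
  pairwiseDisjoint' := by
    rintro ⟨_, ⟨i, rfl⟩⟩ - ⟨_, ⟨j, rfl⟩⟩ - hij
    rw [Function.onFun, Set.disjoint_left]
    rintro _ ⟨v, hv, rfl⟩ ⟨w, hw, hvw⟩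
    rw [mem_ball_zero_iff] at hv hw
    obtain rfl := S.disj _ _ _ _ hw hv hvw
    exact hij rfl
  mapsTo' := by
    rintro _ ⟨i, rfl⟩
    obtain ⟨F, hF, hb⟩ := S.boundary i
    refine ⟨fun m => hF.toFinset.subtype _, fun v hv => ?_⟩
    obtain ⟨j, hj, hji, w, hw, hjw⟩ := hb v (by simpa using hv)
    simp only [Set.mem_iUnion]
    exact ⟨S.dim j, hji, ⟨j, rfl⟩, by simpa using hj, w, by simpa using hw.le, hjw⟩
  closed' A _ hA := by
    refine S.isClosed_of A fun i => ?_
    have h1 := hA _ ⟨i, rfl⟩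
    have h2 := (S.continuousOn i).preimage_isClosed_of_isClosed (isClosed_cube _) h1
    convert h2 using 1
    ext v
    constructor
    · rintro ⟨h3, h4⟩
      exact ⟨h3, h4, v, by simpa using h3, rfl⟩
    · rintro ⟨h3, h4, -⟩
      exact ⟨h3, h4⟩
  union' := by
    rw [Set.eq_univ_iff_forall]
    intro z
    obtain ⟨⟨i, v⟩, hv, rfl⟩ := S.cover z
    simp only [Set.mem_iUnion]
    exact ⟨_, ⟨i, rfl⟩, v, by simpa using hv.le, rfl⟩

/-- The cell structure of a `CWComplex`. -/
noncomputable def ofCWComplex [T2Space Z] [Topology.CWComplex (Set.univ : Set Z)] :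
    CellStructure Z where
  ι := Σ n, Topology.RelCWComplex.cell (Set.univ : Set Z) n
  dim i := i.1
  map i := Topology.RelCWComplex.map i.1 i.2
  continuousOn i := by
    rw [cube_eq]
    exact Topology.RelCWComplex.continuousOn _ _
  cover z := by
    have : z ∈ ⋃ (n : ℕ) (j : Topology.RelCWComplex.cell (Set.univ : Set Z) n),
        Topology.RelCWComplex.openCell n j := by
      rw [Topology.CWComplex.iUnion_openCell_eq_complex]
      trivial
    simp only [Set.mem_iUnion] at this
    obtain ⟨n, j, v, hv, rfl⟩ := this
    exact ⟨⟨⟨n, j⟩, v⟩, by simpa using hv, rfl⟩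
  disj := by
    rintro ⟨n, i⟩ ⟨m, j⟩ v w hv hw hvw
    by_contra hne
    exact Set.disjoint_left.1 (Topology.RelCWComplex.disjoint_openCell_of_ne hne)
      ⟨v, by simpa using hv, rfl⟩ ⟨w, by simpa using hw, hvw.symm⟩
  inj := by
    rintro ⟨n, i⟩ v w hv hw hvw
    exact (Topology.RelCWComplex.map n i).injOn
      (by rw [Topology.RelCWComplex.source_eq]; simpa using hv)
      (by rw [Topology.RelCWComplex.source_eq]; simpa using hw) hvw
  boundary := by
    rintro ⟨n, i⟩
    obtain ⟨F, hF⟩ := Topology.CWComplex.cellFrontier_subset_finite_openCell n i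
    refine ⟨(Finset.range n).sigma F, Finset.finite_toSet _, fun v hv => ?_⟩
    have := hF ⟨v, by simpa using hv, rfl⟩
    simp only [Set.mem_iUnion] at this
    obtain ⟨m, hm, j, hj, w, hw, hjw⟩ := this
    exact ⟨⟨m, j⟩, by simpa using ⟨hm, hj⟩, hm, w, by simpa using hw, hjw⟩
  isClosed_of A hA := by
    refine Topology.CWComplex.closed' A (Set.subset_univ _)
      fun n (j : Topology.RelCWComplex.cell (Set.univ : Set Z) n) => ?_
    have h1 := ((isCompact_cube _).of_isClosed_subset (hA ⟨n, j⟩)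
      Set.inter_subset_left).image_of_continuousOn ((Topology.RelCWComplex.continuousOn n j).mono
        (by rw [← cube_eq]; exact Set.inter_subset_left))
    convert h1.isClosed using 1
    ext z
    constructor
    · rintro ⟨hz, v, hv, rfl⟩
      exact ⟨v, ⟨by simpa using hv, hz⟩, rfl⟩
    · rintro ⟨v, ⟨hv, hz⟩, rfl⟩
      exact ⟨hz, v, by simpa using hv, rfl⟩

end CellStructure

/-- A cell structure in which the base point is a vertex. -/
structure PtdCellStructure (X : PtdSpace.{u}) extends CellStructure X where
  /-- The cell of the base point. -/
  base : ι
  dim_base : dim base = 0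
  map_base : ∀ v, map base v = X.pt

theorem isCW_iff {X : PtdSpace.{u}} : X.IsCW ↔ T2Space X ∧ Nonempty (PtdCellStructure X) := by
  constructor
  · rintro ⟨hT, h, e, he⟩
    refine ⟨hT, ⟨{ CellStructure.ofCWComplex with base := ⟨0, e⟩, dim_base := rfl, map_base := ?_ }⟩⟩
    intro (v : Fin 0 → ℝ)
    have : Topology.RelCWComplex.map 0 e v ∈
        Topology.RelCWComplex.closedCell (C := (Set.univ : Set X)) 0 e :=
      ⟨v, by simp [Subsingleton.elim v 0], rfl⟩
    rw [he] at this
    exact this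
  · rintro ⟨hT, ⟨S⟩⟩
    refine ⟨hT, S.toCWComplex, ⟨S.base, S.dim_base⟩, ?_⟩
    -- The dimension is generalized so that the transport along `h` can be eliminated.
    have key : ∀ (n : ℕ) (h : S.dim S.base = n) (v : Fin n → ℝ),
        (h ▸ S.partialEquiv S.base : PartialEquiv (Fin n → ℝ) X) v = X.pt := by
      rintro _ rfl v
      exact S.map_base v
    ext z
    constructor
    · rintro ⟨v, -, rfl⟩
      exact key _ _ _
    · rintro rfl
      exact ⟨0, by simp, key _ _ _⟩

end PtdSpace

namespace PtdSpace

open Topology unitInterval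

variable {X Y Z W A B : PtdSpace.{u}}

/-! ### Half-smash products -/

/-- The equivalence relation that collapses `{*} × A`. -/
def halfSmashSetoid (X A : PtdSpace.{u}) : Setoid (CompactCoherentification (X × A)) where
  r p q := p = q ∨ (((CompactCoherentification.mk (X × A)).symm p).1 = X.pt ∧
    ((CompactCoherentification.mk (X × A)).symm q).1 = X.pt)
  iseqv :=
    { refl := fun _ => Or.inl rfl
      symm := by
        rintro p q (h | h)
        · exact Or.inl h.symm
        · exact Or.inr ⟨h.2, h.1⟩
      trans := by
        rintro p q r (rfl | h) (rfl | h')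
        · exact Or.inl rfl
        · exact Or.inr h'
        · exact Or.inr h
        · exact Or.inr ⟨h.1, h'.2⟩ }

/-- The half-smash product `(X × A) / ({*} × A)`, formed in compactly generated spaces. -/
noncomputable def halfSmash (X A : PtdSpace.{u}) : PtdSpace.{u} where
  carrier := Quotient (halfSmashSetoid X A)
  pt := Quotient.mk _ (CompactCoherentification.mk _ (X.pt, A.pt))

/-- The point of the half-smash product given by a pair. -/
noncomputable def halfSmashMk (X A : PtdSpace.{u}) (p : X × A) : halfSmash X A :=
  Quotient.mk (halfSmashSetoid X A) (CompactCoherentification.mk _ p)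

theorem isQuotientMap_halfSmashMk : IsQuotientMap
    (halfSmashMk X A ∘ (CompactCoherentification.mk (X × A)).symm) := isQuotientMap_quotient_mk'

theorem halfSmashMk_eq_iff {p q : X × A} : halfSmashMk X A p = halfSmashMk X A q ↔
    p = q ∨ (p.1 = X.pt ∧ q.1 = X.pt) := Quotient.eq

theorem halfSmashMk_surjective : Function.Surjective (halfSmashMk X A) := by
  rintro ⟨p⟩
  exact ⟨(CompactCoherentification.mk _).symm p, rfl⟩

theorem halfSmash_pt : (halfSmash X A).pt = halfSmashMk X A (X.pt, A.pt) := rfl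

@[simp] theorem halfSmashMk_pt (a : A) : halfSmashMk X A (X.pt, a) = (halfSmash X A).pt :=
  halfSmashMk_eq_iff.2 (Or.inr ⟨rfl, rfl⟩)

theorem halfSmashMk_eq_pt_iff {p : X × A} :
    halfSmashMk X A p = (halfSmash X A).pt ↔ p.1 = X.pt := by
  rw [halfSmash_pt, halfSmashMk_eq_iff]
  constructor
  · rintro (rfl | h)
    · rfl
    · exact h.1
  · exact fun h => Or.inr ⟨h, rfl⟩

theorem continuousOn_halfSmashMk {K : Set (X × A)} (hK : IsCompact K) :
    ContinuousOn (halfSmashMk X A) K :=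
  isQuotientMap_halfSmashMk.continuous.comp_continuousOn
    (CompactCoherentification.continuousOn_isCompact_mk hK)

theorem continuous_halfSmash_iff {V : Type*} [TopologicalSpace V] {g : halfSmash X A → V} :
    Continuous g ↔ ∀ K : Set (X × A), IsCompact K → ContinuousOn (fun p => g (halfSmashMk X A p)) K := by
  rw [isQuotientMap_halfSmashMk.continuous_iff, CompactCoherentification.continuous_dom_iff]
  rfl

theorem isClosed_halfSmash_iff {C : Set (halfSmash X A)} : IsClosed C ↔
    ∀ K : Set (X × A), IsCompact K →
      IsClosed (Subtype.val ⁻¹' (halfSmashMk X A ⁻¹' C) : Set K) := by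
  rw [← isQuotientMap_halfSmashMk.isClosed_preimage, CompactCoherentification.isClosed_iff]
  rfl

/-- The projection to the first factor. -/
noncomputable def halfSmashFst (X A : PtdSpace.{u}) : PMap (halfSmash X A) X where
  toFun := Quotient.lift (fun p => ((CompactCoherentification.mk (X × A)).symm p).1) (by
    rintro p q (rfl | h)
    · rfl
    · exact h.1.trans h.2.symm)
  cont := (continuous_fst.comp CompactCoherentification.continuous_mk_symm).quotient_lift _
  map_pt := rfl

/-- Away from the collapsed set the projection is injective, so `U` is saturated. -/
theorem isOpen_image_halfSmashMk {U : Set (X × A)} (hU : IsOpen U) (h : ∀ p ∈ U, p.1 ≠ X.pt) :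
    IsOpen (halfSmashMk X A '' U) := by
  rw [← isQuotientMap_halfSmashMk.isOpen_preimage]
  convert hU.preimage CompactCoherentification.continuous_mk_symm using 1
  ext z
  constructor
  · rintro ⟨p, hp, hpz⟩
    rcases halfSmashMk_eq_iff.1 hpz with h' | h'
    · rw [h'] at hp
      exact hp
    · exact absurd h'.1 (h p hp)
  · exact fun hz => ⟨_, hz, rfl⟩

/-- Points with different first coordinates are separated in `X`. Otherwise the common first
coordinate is not the base point, and the second coordinates are separated in `A`. -/
instance [T2Space X] [T2Space A] : T2Space (halfSmash X A) where
  t2 a b hab := by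
    by_cases h : halfSmashFst X A a = halfSmashFst X A b
    · obtain ⟨⟨x, a⟩, rfl⟩ := halfSmashMk_surjective a
      obtain ⟨⟨y, b⟩, rfl⟩ := halfSmashMk_surjective b
      obtain rfl : x = y := h
      have hx : x ≠ X.pt := fun hx => hab (halfSmashMk_eq_iff.2 (Or.inr ⟨hx, hx⟩))
      obtain ⟨U, V, hU, hV, haU, hbV, hUV⟩ := t2_separation (x := a) (y := b)
        fun h => hab (h ▸ rfl)
      have hne : IsOpen ({X.pt}ᶜ : Set X) := isOpen_compl_singleton
      refine ⟨_, _, isOpen_image_halfSmashMk (hne.prod hU) fun p hp => hp.1,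
        isOpen_image_halfSmashMk (hne.prod hV) fun p hp => hp.1, ⟨(x, a), ⟨hx, haU⟩, rfl⟩,
        ⟨(x, b), ⟨hx, hbV⟩, rfl⟩, ?_⟩
      rw [Set.disjoint_left]
      rintro _ ⟨p, hp, rfl⟩ ⟨q, hq, hpq⟩
      rcases halfSmashMk_eq_iff.1 hpq with rfl | h'
      · exact Set.disjoint_left.1 hUV hp.2 hq.2
      · exact hq.1 h'.1
    · exact separated_by_continuous (halfSmashFst X A).cont h

/-! ### Compact subsets -/

/-- Choose one point of `K` in each open cell that `K` meets. Every closed cell contains finitely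
many of them, so each subset of the chosen set `P` is closed; an infinite `P` would then have no
accumulation point in the compact set `K`. -/
theorem CellStructure.finite_cells_of_isCompact {Z : Type u} [TopologicalSpace Z] [T2Space Z]
    (S : CellStructure Z) {K : Set Z} (hK : IsCompact K) :
    ((fun z => (S.coord z).1) '' K).Finite := by
  by_contra hinf
  obtain ⟨P, hPK, hP⟩ := Set.SurjOn.exists_bijOn_subset (Set.surjOn_image (fun z => (S.coord z).1) K)
  have hPinf : P.Infinite := fun h => hinf (hP.image_eq ▸ h.image _)
  have hcl : ∀ Q ⊆ P, IsClosed Q := by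
    intro Q hQ
    refine S.isClosed_of Q fun i => ?_
    have hfin : (Q ∩ S.map i '' Cube (S.dim i)).Finite := by
      obtain ⟨F, hF, hb⟩ := S.boundary i
      refine Set.Finite.of_finite_image ((hF.insert i).subset ?_)
        (hP.injOn.mono (Set.inter_subset_left.trans hQ))
      rintro _ ⟨_, ⟨-, v, hv, rfl⟩, rfl⟩
      rcases lt_or_eq_of_le (show ‖v‖ ≤ 1 from hv) with hv | hv
      · left
        simp only
        rw [S.coord_map i v hv]
      · right
        obtain ⟨j, hj, -, w, hw, hjw⟩ := hb v hv
        simp only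
        rw [← hjw, S.coord_map j w hw]
        exact hj
    have := (S.continuousOn i).preimage_isClosed_of_isClosed (isClosed_cube _) hfin.isClosed
    convert this using 1
    ext v
    constructor
    · rintro ⟨h1, h2⟩
      exact ⟨h1, h2, v, h1, rfl⟩
    · rintro ⟨h1, h2, -⟩
      exact ⟨h1, h2⟩
  obtain ⟨x, -, hx⟩ := hPinf.exists_accPt_of_subset_isCompact hK hPK
  rw [accPt_principal_iff_clusterPt, ← mem_closure_iff_clusterPt,
    (hcl _ Set.sdiff_subset).closure_eq] at hx
  exact hx.2 rfl

namespace PtdCellStructure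

theorem eq_base_of_map {X : PtdSpace.{u}} (S : PtdCellStructure X) {i : S.ι} {v} (hv : ‖v‖ < 1)
    (h : S.map i v = X.pt) : i = S.base := by
  refine S.disj i S.base v 0 hv (by simp) ?_
  rw [h, S.map_base]

theorem map_of_eq_base {X : PtdSpace.{u}} (S : PtdCellStructure X) {i : S.ι} (h : i = S.base) (v) :
    S.map i v = X.pt := by
  subst h
  exact S.map_base v

theorem norm_zero_lt (n : ℕ) : ‖(0 : Fin n → ℝ)‖ < 1 := by simp

/-! ### Cell structures on wedges -/

open Classical in
/-- The cell of the wedge that contains the image of a cell of the second summand. -/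
noncomputable def wedgeCell (S : PtdCellStructure A) (R : PtdCellStructure B) (j : R.ι) :
    S.ι ⊕ {j : R.ι // j ≠ R.base} :=
  if h : j = R.base then .inl S.base else .inr ⟨j, h⟩

/-- The cell structure of a wedge. -/
noncomputable def wedge [T2Space A] [T2Space B] (S : PtdCellStructure A)
    (R : PtdCellStructure B) : PtdCellStructure (wedge A B) where
  ι := S.ι ⊕ {j : R.ι // j ≠ R.base}
  dim := Sum.elim S.dim fun j => R.dim j.1
  map i := match i with
    | .inl i => fun v => wedgeInl A B (S.map i v)
    | .inr j => fun v => wedgeInr A B (R.map j.1 v)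
  continuousOn := by
    rintro (i | j)
    · exact (wedgeInl A B).cont.comp_continuousOn (S.continuousOn i)
    · exact (wedgeInr A B).cont.comp_continuousOn (R.continuousOn j.1)
  cover z := by
    rcases wedge_cases z with ⟨a, rfl⟩ | ⟨b, rfl⟩
    · obtain ⟨⟨i, v⟩, hv, rfl⟩ := S.cover a
      exact ⟨⟨.inl i, v⟩, hv, rfl⟩
    · obtain ⟨⟨j, v⟩, hv, rfl⟩ := R.cover b
      by_cases hj : j = R.base
      · refine ⟨⟨.inl S.base, 0⟩, norm_zero_lt _, ?_⟩
        change wedgeInl A B (S.map S.base 0) = wedgeInr A B (R.map j v)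
        rw [S.map_base, R.map_of_eq_base hj, PMap.apply_pt, PMap.apply_pt]
      · exact ⟨⟨.inr ⟨j, hj⟩, v⟩, hv, rfl⟩
  disj := by
    rintro (i | i) (j | j) v w hv hw h
    · exact congrArg _ (S.disj _ _ _ _ hv hw (congrArg (fun p => p.1.1) h))
    · exact absurd (R.eq_base_of_map hw (congrArg (fun p => p.1.2) h).symm) j.2
    · exact absurd (R.eq_base_of_map hv (congrArg (fun p => p.1.2) h)) i.2
    · exact congrArg _ (Subtype.ext (R.disj _ _ _ _ hv hw (congrArg (fun p => p.1.2) h)))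
  inj := by
    rintro (i | i) v w hv hw h
    · exact S.inj _ _ _ hv hw (congrArg (fun p => p.1.1) h)
    · exact R.inj _ _ _ hv hw (congrArg (fun p => p.1.2) h)
  boundary := by
    rintro (i | i)
    · obtain ⟨F, hF, hb⟩ := S.boundary i
      refine ⟨Sum.inl '' F, hF.image _, fun v hv => ?_⟩
      obtain ⟨j, hj, hji, w, hw, hjw⟩ := hb v hv
      exact ⟨.inl j, ⟨j, hj, rfl⟩, hji, w, hw, congrArg (wedgeInl A B) hjw⟩
    · obtain ⟨F, hF, hb⟩ := R.boundary i.1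
      refine ⟨wedgeCell S R '' F, hF.image _, fun v hv => ?_⟩
      obtain ⟨j, hj, hji, w, hw, hjw⟩ := hb v hv
      refine ⟨_, ⟨j, hj, rfl⟩, ?_⟩
      by_cases h : j = R.base
      · rw [wedgeCell, dif_pos h]
        refine ⟨?_, 0, norm_zero_lt _, ?_⟩
        · change S.dim S.base < _
          rw [S.dim_base]
          exact (Nat.zero_le _).trans_lt hji
        · change wedgeInl A B (S.map S.base 0) = wedgeInr A B (R.map i.1 v)
          rw [S.map_base, ← hjw, R.map_of_eq_base h, PMap.apply_pt, PMap.apply_pt]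
      · rw [wedgeCell, dif_neg h]
        exact ⟨hji, w, hw, congrArg (wedgeInr A B) hjw⟩
  isClosed_of C hC := by
    have h1 : IsClosed (wedgeInl A B ⁻¹' C) := S.isClosed_of _ fun i => hC (.inl i)
    have h2 : IsClosed (wedgeInr A B ⁻¹' C) := by
      refine R.isClosed_of _ fun j => ?_
      by_cases hj : j = R.base
      · by_cases hp : (PtdSpace.wedge A B).pt ∈ C
        · convert isClosed_cube (R.dim j) using 1
          ext v
          simp [R.map_of_eq_base hj, hp]
        · convert isClosed_empty using 1
          ext v
          simp [R.map_of_eq_base hj, hp]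
      · exact hC (.inr ⟨j, hj⟩)
    rw [← isOpen_compl_iff] at h1 h2 ⊢
    -- Openness is continuity of the indicator into the Sierpiński space `Prop`, so the gluing lemma
    -- for maps applies.
    exact continuous_Prop.1 (continuous_wedge (h := fun z => z ∈ Cᶜ) (continuous_Prop.2 h1)
      (continuous_Prop.2 h2))
  base := .inl S.base
  dim_base := S.dim_base
  map_base v := by
    exact (congrArg (wedgeInl A B) (S.map_base v)).trans (PMap.apply_pt _)

/-! ### Cell structures on half-smash products -/

/-- The characteristic map of a product cell. -/
def prodMap (S : PtdCellStructure X) (R : PtdCellStructure A) (c : S.ι × R.ι)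
    (v : Fin (S.dim c.1 + R.dim c.2) → ℝ) : X × A :=
  (S.map c.1 fun i => v (Fin.castAdd _ i), R.map c.2 fun i => v (Fin.natAdd _ i))

theorem norm_append_lt_iff {m n : ℕ} {v : Fin (m + n) → ℝ} : ‖v‖ < 1 ↔
    ‖fun i => v (Fin.castAdd n i)‖ < 1 ∧ ‖fun i => v (Fin.natAdd m i)‖ < 1 := by
  simp only [pi_norm_lt_iff zero_lt_one]
  exact Fin.forall_fin_add _

theorem norm_append_le_iff {m n : ℕ} {v : Fin (m + n) → ℝ} : ‖v‖ ≤ 1 ↔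
    ‖fun i => v (Fin.castAdd n i)‖ ≤ 1 ∧ ‖fun i => v (Fin.natAdd m i)‖ ≤ 1 := by
  simp only [pi_norm_le_iff_of_nonneg zero_le_one]
  exact Fin.forall_fin_add _

theorem continuousOn_prodMap (S : PtdCellStructure X) (R : PtdCellStructure A) (c : S.ι × R.ι) :
    ContinuousOn (S.prodMap R c) (Cube _) :=
  ((S.continuousOn c.1).comp (f := fun (v : Fin (S.dim c.1 + R.dim c.2) → ℝ) i =>
    v (Fin.castAdd (R.dim c.2) i)) (by fun_prop)
    fun _ hv => (norm_append_le_iff.1 hv).1).prodMk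
  ((R.continuousOn c.2).comp (f := fun (v : Fin (S.dim c.1 + R.dim c.2) → ℝ) i =>
    v (Fin.natAdd (S.dim c.1) i)) (by fun_prop)
    fun _ hv => (norm_append_le_iff.1 hv).2)

theorem prodMap_append (S : PtdCellStructure X) (R : PtdCellStructure A) (c : S.ι × R.ι) (v w) :
    S.prodMap R c (Fin.append v w) = (S.map c.1 v, R.map c.2 w) := by
  simp [prodMap]

theorem norm_append_lt {m n : ℕ} {v : Fin m → ℝ} {w : Fin n → ℝ} (hv : ‖v‖ < 1) (hw : ‖w‖ < 1) :
    ‖Fin.append v w‖ < 1 := by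
  rw [norm_append_lt_iff]
  simp [hv, hw]

theorem exists_prodMap_eq (S : PtdCellStructure X) (R : PtdCellStructure A) (p : X × A) :
    ∃ v, ‖v‖ < 1 ∧ S.prodMap R ((S.coord p.1).1, (R.coord p.2).1) v = p := by
  refine ⟨Fin.append (S.coord p.1).2 (R.coord p.2).2,
    norm_append_lt (S.norm_coord _) (R.norm_coord _), ?_⟩
  rw [prodMap_append]
  exact Prod.ext (S.map_coord _) (R.map_coord _)

theorem prodMap_disj (S : PtdCellStructure X) (R : PtdCellStructure A) {c d : S.ι × R.ι} {v w}
    (hv : ‖v‖ < 1) (hw : ‖w‖ < 1) (h : S.prodMap R c v = S.prodMap R d w) : c = d := by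
  rw [norm_append_lt_iff] at hv hw
  exact Prod.ext (S.disj _ _ _ _ hv.1 hw.1 (congrArg Prod.fst h))
    (R.disj _ _ _ _ hv.2 hw.2 (congrArg Prod.snd h))

theorem prodMap_inj (S : PtdCellStructure X) (R : PtdCellStructure A) {c : S.ι × R.ι} {v w}
    (hv : ‖v‖ < 1) (hw : ‖w‖ < 1) (h : S.prodMap R c v = S.prodMap R c w) : v = w := by
  rw [norm_append_lt_iff] at hv hw
  have h1 := S.inj _ _ _ hv.1 hw.1 (congrArg Prod.fst h)
  have h2 := R.inj _ _ _ hv.2 hw.2 (congrArg Prod.snd h)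
  funext i
  exact Fin.addCases (motive := fun i => v i = w i) (fun i => congrFun h1 i)
    (fun i => congrFun h2 i) i

theorem prodMap_boundary (S : PtdCellStructure X) (R : PtdCellStructure A) (c : S.ι × R.ι) :
    ∃ F : Set (S.ι × R.ι), F.Finite ∧ ∀ v, ‖v‖ = 1 → ∃ d ∈ F,
      S.dim d.1 + R.dim d.2 < S.dim c.1 + R.dim c.2 ∧
      ∃ w, ‖w‖ < 1 ∧ S.prodMap R d w = S.prodMap R c v := by
  obtain ⟨F, hF, hb⟩ := S.exists_boundary_le c.1
  obtain ⟨F', hF', hb'⟩ := R.exists_boundary_le c.2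
  refine ⟨F ×ˢ F', hF.prod hF', fun v hv => ?_⟩
  have hle := norm_append_le_iff.1 hv.le
  obtain ⟨j, hj, hji, hjl, w, hw, hjw⟩ := hb _ hle.1
  obtain ⟨j', hj', hji', hjl', w', hw', hjw'⟩ := hb' _ hle.2
  refine ⟨(j, j'), ⟨hj, hj'⟩, ?_, Fin.append w w', norm_append_lt hw hw', ?_⟩
  · by_cases h1 : ‖fun i => v (Fin.castAdd (R.dim c.2) i)‖ = 1
    · have := hjl h1
      simp only
      omega
    by_cases h2 : ‖fun i => v (Fin.natAdd (S.dim c.1) i)‖ = 1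
    · have := hjl' h2
      simp only
      omega
    · exact absurd hv (norm_append_lt_iff.2
        ⟨lt_of_le_of_ne hle.1 h1, lt_of_le_of_ne hle.2 h2⟩).ne
  · rw [prodMap_append]
    exact Prod.ext hjw hjw'

open Classical in
/-- The cell of the half-smash product that contains the image of a product cell. -/
noncomputable def halfSmashCell (S : PtdCellStructure X) (R : PtdCellStructure A) (c : S.ι × R.ι) :
    {c : S.ι × R.ι // c.1 ≠ S.base ∨ c = (S.base, R.base)} :=
  if h : c.1 = S.base then ⟨(S.base, R.base), Or.inr rfl⟩ else ⟨c, Or.inl h⟩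

/-- The cell structure of a half-smash product. -/
noncomputable def halfSmash [T2Space X] [T2Space A] (S : PtdCellStructure X)
    (R : PtdCellStructure A) : PtdCellStructure (halfSmash X A) where
  -- All product cells over the base vertex of `X` collapse to one point; the pair of base cells
  -- represents it.
  ι := {c : S.ι × R.ι // c.1 ≠ S.base ∨ c = (S.base, R.base)}
  dim c := S.dim c.1.1 + R.dim c.1.2
  map c v := halfSmashMk X A (S.prodMap R c.1 v)
  continuousOn c := (continuousOn_halfSmashMk ((isCompact_cube _).image_of_continuousOn
    (S.continuousOn_prodMap R c.1))).comp (S.continuousOn_prodMap R c.1) (Set.mapsTo_image _ _)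
  cover z := by
    obtain ⟨p, rfl⟩ := halfSmashMk_surjective z
    by_cases hp : p.1 = X.pt
    · refine ⟨⟨⟨(S.base, R.base), Or.inr rfl⟩, 0⟩, norm_zero_lt _, ?_⟩
      exact halfSmashMk_eq_iff.2 (Or.inr ⟨S.map_base _, hp⟩)
    · obtain ⟨v, hv, h⟩ := exists_prodMap_eq S R p
      refine ⟨⟨⟨_, Or.inl fun hc => hp ?_⟩, v⟩, hv, congrArg _ h⟩
      rw [← h]
      exact S.map_of_eq_base hc _
  disj := by
    rintro ⟨c, hc⟩ ⟨d, hd⟩ v w hv hw h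
    rcases halfSmashMk_eq_iff.1 h with h | ⟨h, h'⟩
    · exact Subtype.ext (prodMap_disj S R hv hw h)
    · have h1 := S.eq_base_of_map (norm_append_lt_iff.1 hv).1 h
      have h2 := S.eq_base_of_map (norm_append_lt_iff.1 hw).1 h'
      refine Subtype.ext ?_
      exact (hc.resolve_left (not_not.2 h1)).trans (hd.resolve_left (not_not.2 h2)).symm
  inj := by
    rintro ⟨c, hc⟩ v w hv hw h
    rcases halfSmashMk_eq_iff.1 h with h | ⟨h, h'⟩
    · exact prodMap_inj S R hv hw h
    · have h1 := S.eq_base_of_map (norm_append_lt_iff.1 hv).1 h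
      obtain rfl := hc.resolve_left (not_not.2 h1)
      have : IsEmpty (Fin (S.dim S.base + R.dim R.base)) := by
        rw [S.dim_base, R.dim_base]
        exact Fin.isEmpty
      exact Subsingleton.elim (α := Fin (S.dim S.base + R.dim R.base) → ℝ) v w
  boundary c := by
    obtain ⟨F, hF, hb⟩ := prodMap_boundary S R c.1
    refine ⟨halfSmashCell S R '' F, hF.image _, fun v hv => ?_⟩
    obtain ⟨d, hd, hdc, w, hw, h⟩ := hb v hv
    refine ⟨_, ⟨d, hd, rfl⟩, ?_⟩
    by_cases h' : d.1 = S.base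
    · rw [halfSmashCell, dif_pos h']
      refine ⟨?_, 0, norm_zero_lt _, ?_⟩
      · simp only [S.dim_base, R.dim_base]
        omega
      · rw [← h]
        exact halfSmashMk_eq_iff.2 (Or.inr ⟨S.map_base _, S.map_of_eq_base h' _⟩)
    · rw [halfSmashCell, dif_neg h']
      exact ⟨hdc, w, hw, congrArg _ h⟩
  isClosed_of C hC := by
    rw [isClosed_halfSmash_iff]
    intro K hK
    have hcl : ∀ c : S.ι × R.ι,
        IsClosed (Cube _ ∩ (fun v => halfSmashMk X A (S.prodMap R c v)) ⁻¹' C) := by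
      intro c
      by_cases hc : c.1 = S.base
      · have : ∀ v, halfSmashMk X A (S.prodMap R c v) = (PtdSpace.halfSmash X A).pt := fun v =>
          halfSmashMk_eq_pt_iff.2 (S.map_of_eq_base hc _)
        by_cases hp : (PtdSpace.halfSmash X A).pt ∈ C
        · convert isClosed_cube (S.dim c.1 + R.dim c.2) using 1
          ext v
          simp [this, hp]
        · convert isClosed_empty using 1
          ext v
          simp [this, hp]
      · exact hC ⟨c, Or.inl hc⟩
    -- Both projections of `K` meet finitely many cells, so on `K` the preimage of `C` agrees with a
    -- finite union of compact sets.
    have h1 := S.finite_cells_of_isCompact (hK.image continuous_fst)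
    have h2 := R.finite_cells_of_isCompact (hK.image continuous_snd)
    have h3 : IsClosed (⋃ c ∈ ((fun z => (S.coord z).1) '' (Prod.fst '' K)) ×ˢ
        ((fun z => (R.coord z).1) '' (Prod.snd '' K)), S.prodMap R c '' (Cube _ ∩
          (fun v => halfSmashMk X A (S.prodMap R c v)) ⁻¹' C)) :=
      (h1.prod h2).isClosed_biUnion fun c _ =>
        (((isCompact_cube _).of_isClosed_subset (hcl c)
          Set.inter_subset_left).image_of_continuousOn
            ((S.continuousOn_prodMap R c).mono Set.inter_subset_left)).isClosed
    convert h3.preimage continuous_subtype_val using 1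
    ext ⟨p, hp⟩
    simp only [Set.mem_preimage, Set.mem_iUnion]
    constructor
    · intro hpC
      obtain ⟨v, hv, h⟩ := exists_prodMap_eq S R p
      refine ⟨_, ⟨⟨p.1, ⟨p, hp, rfl⟩, rfl⟩, ⟨p.2, ⟨p, hp, rfl⟩, rfl⟩⟩, v, ⟨hv.le, ?_⟩, h⟩
      rw [Set.mem_preimage, h]
      exact hpC
    · rintro ⟨c, -, v, ⟨-, hv⟩, h⟩
      rw [← h]
      exact hv
  base := ⟨(S.base, R.base), Or.inr rfl⟩
  dim_base := by simp only [S.dim_base, R.dim_base]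
  map_base v := halfSmashMk_eq_pt_iff.2 (S.map_base _)

end PtdCellStructure

end PtdSpace

namespace PtdSpace

open Topology unitInterval

/-! ### The stages of the Whitehead filtration -/

variable {k : ℕ} {X : Fin k → PtdSpace.{u}} {l : ℕ}

/-- The set of the indices of the coordinates that are the base point. -/
def ptIndices (x : ∀ i, X i) : Set (Fin k) := {i | x i = (X i).pt}

/-- The coordinates of a point of a stage. -/
noncomputable def stageVal (y : whiteheadStage X l) : ∀ i, X i :=
  (CompactCoherentification.mk (∀ i, X i)).symm y.1

/-- The point of a stage with given coordinates. -/
noncomputable def stageMk (x : ∀ i, X i) (hx : k - l ≤ (ptIndices x).ncard) : whiteheadStage X l :=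
  ⟨CompactCoherentification.mk (∀ i, X i) x, hx⟩

theorem stageVal_mem (y : whiteheadStage X l) : k - l ≤ (ptIndices (stageVal y)).ncard := y.2

theorem stageVal_injective : Function.Injective (stageVal (X := X) (l := l)) := fun _ _ h =>
  Subtype.ext h

theorem continuous_stageVal : Continuous (stageVal (X := X) (l := l)) :=
  CompactCoherentification.continuous_mk_symm.comp continuous_subtype_val

theorem isClosed_stage_iff {A : Set (whiteheadStage X l)} (h : ∀ K : Set (∀ i, X i), IsCompact K →
    IsClosed (Subtype.val ⁻¹' (stageVal '' A) : Set K)) : IsClosed A := by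
  have h1 : IsClosed (Subtype.val '' A : Set (CompactCoherentification (∀ i, X i))) :=
    CompactCoherentification.isClosed_iff.2 h
  have h2 := h1.preimage (continuous_subtype_val : Continuous (Subtype.val :
    {x : CompactCoherentification (∀ i, X i) // k - l ≤ {i | (CompactCoherentification.mk
      (∀ i, X i)).symm x i = (X i).pt}.ncard} → _))
  have e : Subtype.val ⁻¹' (Subtype.val '' A) = A := Set.preimage_image_eq A Subtype.val_injective
  exact e ▸ h2

/-- A map from a compact set to a stage is continuous if its coordinates are. -/
theorem continuousOn_stage {E : Type*} [TopologicalSpace E] {K : Set E} (hK : IsCompact K)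
    {f : E → whiteheadStage X l} (hf : ContinuousOn (fun e => stageVal (f e)) K) :
    ContinuousOn f K := by
  have h1 : ContinuousOn (fun e => (f e).1) K :=
    (CompactCoherentification.continuousOn_rng_of_isCompact hK).2 hf
  rw [continuousOn_iff_continuous_domRestrict] at h1 ⊢
  exact h1.subtype_mk _

instance [∀ i, T2Space (X i)] : T2Space (whiteheadStage X l) :=
  T2Space.of_injective_continuous stageVal_injective continuous_stageVal

/-! ### Blocks of coordinates -/

/-- A block of coordinates. -/
def block (n : Fin k → ℕ) (v : Fin (∑ i, n i) → ℝ) (i : Fin k) (a : Fin (n i)) : ℝ :=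
  v (finSigmaFinEquiv ⟨i, a⟩)

/-- The vector with given blocks. -/
def unblock (n : Fin k → ℕ) (w : ∀ i, Fin (n i) → ℝ) (a : Fin (∑ i, n i)) : ℝ :=
  w (finSigmaFinEquiv.symm a).1 (finSigmaFinEquiv.symm a).2

@[simp] theorem block_unblock (n : Fin k → ℕ) (w : ∀ i, Fin (n i) → ℝ) :
    block n (unblock n w) = w := by
  funext i a
  have : ∀ s : Σ i, Fin (n i), s = ⟨i, a⟩ → w s.1 s.2 = w i a := by
    rintro _ rfl
    rfl
  exact this _ (finSigmaFinEquiv.symm_apply_apply _)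

theorem block_injective (n : Fin k → ℕ) : Function.Injective (block n) := by
  intro v w h
  funext a
  obtain ⟨⟨i, b⟩, rfl⟩ := finSigmaFinEquiv.surjective a
  exact congrFun (congrFun h i) b

theorem norm_block_lt_iff (n : Fin k → ℕ) (v : Fin (∑ i, n i) → ℝ) :
    ‖v‖ < 1 ↔ ∀ i, ‖block n v i‖ < 1 := by
  simp only [pi_norm_lt_iff zero_lt_one, ← finSigmaFinEquiv.forall_congr_right, Sigma.forall]
  rfl

theorem norm_block_le_iff (n : Fin k → ℕ) (v : Fin (∑ i, n i) → ℝ) :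
    ‖v‖ ≤ 1 ↔ ∀ i, ‖block n v i‖ ≤ 1 := by
  simp only [pi_norm_le_iff_of_nonneg zero_le_one, ← finSigmaFinEquiv.forall_congr_right,
    Sigma.forall]
  rfl

theorem continuous_block (n : Fin k → ℕ) (i : Fin k) : Continuous fun v => block n v i := by
  unfold block
  fun_prop

/-! ### Cell structures on the stages -/

namespace PtdCellStructure

variable (S : ∀ i, PtdCellStructure (X i))

/-- The characteristic map of a product cell. -/
def piMap (c : ∀ i, (S i).ι) (v : Fin (∑ i, (S i).dim (c i)) → ℝ) (i : Fin k) : X i :=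
  (S i).map (c i) (block (fun i => (S i).dim (c i)) v i)

theorem continuousOn_piMap (c : ∀ i, (S i).ι) : ContinuousOn (piMap S c) (Cube _) :=
  continuousOn_pi.2 fun i => ((S i).continuousOn (c i)).comp (continuous_block _ i).continuousOn
    fun _ hv => (norm_block_le_iff _ _).1 hv i

theorem exists_piMap_eq (x : ∀ i, X i) :
    ∃ v, ‖v‖ < 1 ∧ piMap S (fun i => ((S i).coord (x i)).1) v = x := by
  refine ⟨unblock _ fun i => ((S i).coord (x i)).2, ?_, ?_⟩
  · rw [norm_block_lt_iff]
    simp [(S _).norm_coord]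
  · funext i
    simp [piMap, (S i).map_coord]

/-- The indices at which a product cell is the base cell. -/
def baseIndices (c : ∀ i, (S i).ι) : Set (Fin k) := {i | c i = (S i).base}

/-- The number of trivial coordinates is constant on an open product cell, so a stage is a union of
cells. -/
theorem ptIndices_piMap {c : ∀ i, (S i).ι} {v} (hv : ‖v‖ < 1) :
    ptIndices (piMap S c v) = baseIndices S c := by
  ext i
  exact ⟨fun h => (S i).eq_base_of_map ((norm_block_lt_iff _ _).1 hv i) h,
    fun h => (S i).map_of_eq_base h _⟩

theorem le_ncard_piMap {m : ℕ} {c : ∀ i, (S i).ι} (hc : m ≤ (baseIndices S c).ncard) (v) :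
    m ≤ (ptIndices (piMap S c v)).ncard :=
  hc.trans (Set.ncard_le_ncard fun i h => (S i).map_of_eq_base h _)

theorem piMap_boundary (c : ∀ i, (S i).ι) :
    ∃ F : Set (∀ i, (S i).ι), F.Finite ∧ ∀ v, ‖v‖ = 1 → ∃ d ∈ F,
      ∑ i, (S i).dim (d i) < ∑ i, (S i).dim (c i) ∧
      ∃ w, ‖w‖ < 1 ∧ piMap S d w = piMap S c v := by
  choose F hF hb using fun i => (S i).exists_boundary_le (c i)
  refine ⟨Set.univ.pi F, Set.Finite.pi' hF |>.subset fun d hd i => hd i trivial, fun v hv => ?_⟩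
  have hle := (norm_block_le_iff _ _).1 hv.le
  choose d hd hdc hlt w hw h using fun i => hb i _ (hle i)
  refine ⟨d, fun i _ => hd i, ?_, unblock _ w, ?_, ?_⟩
  · have : ∃ i, ‖block (fun i => (S i).dim (c i)) v i‖ = 1 := by
      by_contra! hne
      exact absurd hv ((norm_block_lt_iff _ _).2 fun i => lt_of_le_of_ne (hle i) (hne i)).ne
    obtain ⟨i, hi⟩ := this
    exact Finset.sum_lt_sum (fun i _ => hdc i) ⟨i, Finset.mem_univ i, hlt i hi⟩
  · rw [norm_block_lt_iff]
    simpa using hw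
  · funext i
    simp [piMap, h]

/-- The cell structure of a stage of the Whitehead filtration. -/
noncomputable def stage [∀ i, T2Space (X i)] (l : ℕ) : PtdCellStructure (whiteheadStage X l) where
  ι := {c : ∀ i, (S i).ι // k - l ≤ (baseIndices S c).ncard}
  dim c := ∑ i, (S i).dim (c.1 i)
  map c v := stageMk (piMap S c.1 v) (le_ncard_piMap S c.2 v)
  continuousOn c := continuousOn_stage (isCompact_cube _) (continuousOn_piMap S c.1)
  cover y := by
    obtain ⟨v, hv, h⟩ := exists_piMap_eq S (stageVal y)
    refine ⟨⟨⟨_, ?_⟩, v⟩, hv, stageVal_injective h⟩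
    rw [← ptIndices_piMap S hv, h]
    exact stageVal_mem y
  disj := by
    rintro ⟨c, hc⟩ ⟨d, hd⟩ v w hv hw h
    refine Subtype.ext (funext fun i => ?_)
    exact (S i).disj _ _ _ _ ((norm_block_lt_iff _ _).1 hv i) ((norm_block_lt_iff _ _).1 hw i)
      (congrFun (congrArg stageVal h) i)
  inj := by
    rintro ⟨c, hc⟩ v w hv hw h
    refine block_injective _ (funext fun i => ?_)
    exact (S i).inj _ _ _ ((norm_block_lt_iff _ _).1 hv i) ((norm_block_lt_iff _ _).1 hw i)
      (congrFun (congrArg stageVal h) i)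
  boundary c := by
    obtain ⟨F, hF, hb⟩ := piMap_boundary S c.1
    refine ⟨Subtype.val ⁻¹' F, hF.preimage Subtype.val_injective.injOn, fun v hv => ?_⟩
    obtain ⟨d, hd, hdc, w, hw, h⟩ := hb v hv
    refine ⟨⟨d, ?_⟩, hd, hdc, w, hw, stageVal_injective h⟩
    rw [← ptIndices_piMap S hw, h]
    exact le_ncard_piMap S c.2 v
  isClosed_of A hA := by
    refine isClosed_stage_iff fun K hK => ?_
    -- Each coordinate projection of `K` meets finitely many cells, so finitely many product cells
    -- cover the part of `K` in the stage.
    have h1 := fun i => (S i).finite_cells_of_isCompact (hK.image (continuous_apply i))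
    have h2 := (Set.Finite.pi' h1).preimage (Subtype.val_injective
      (p := fun c : ∀ i, (S i).ι => k - l ≤ (baseIndices S c).ncard)).injOn
    have h3 := h2.isClosed_biUnion (f := fun c => piMap S c.1 '' (Cube _ ∩
      (fun v => stageMk (piMap S c.1 v) (le_ncard_piMap S c.2 v)) ⁻¹' A)) fun c _ =>
        (((isCompact_cube _).of_isClosed_subset (hA c)
          Set.inter_subset_left).image_of_continuousOn
            ((continuousOn_piMap S c.1).mono Set.inter_subset_left)).isClosed
    convert h3.preimage continuous_subtype_val using 1
    ext ⟨x, hx⟩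
    simp only [Set.mem_preimage, Set.mem_iUnion]
    constructor
    · rintro ⟨y, hy, rfl⟩
      obtain ⟨v, hv, h⟩ := exists_piMap_eq S (stageVal y)
      refine ⟨⟨_, ?_⟩, fun i => ⟨_, ⟨_, hx, rfl⟩, rfl⟩, v, ⟨hv.le, ?_⟩, h⟩
      · rw [← ptIndices_piMap S hv, h]
        exact stageVal_mem y
      · have e : ∀ z : whiteheadStage X l, stageVal z = stageVal y → z ∈ A := fun z hz =>
          stageVal_injective hz ▸ hy
        exact e _ h
    · rintro ⟨c, -, v, ⟨-, hv⟩, rfl⟩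
      exact ⟨_, hv, rfl⟩
  base := ⟨fun i => (S i).base, by simp [baseIndices]⟩
  dim_base := by simp [(S _).dim_base]
  map_base v := stageVal_injective (funext fun i => (S i).map_base _)

end PtdCellStructure

theorem isCW_whiteheadStage (hX : ∀ i, (X i).IsCW) : (whiteheadStage X l).IsCW := by
  have : ∀ i, T2Space (X i) := fun i => (isCW_iff.1 (hX i)).1
  exact isCW_iff.2 ⟨inferInstance,
    ⟨PtdCellStructure.stage (fun i => (isCW_iff.1 (hX i)).2.some) l⟩⟩

theorem isCW_halfSmash {X A : PtdSpace.{u}} (hX : X.IsCW) (hA : A.IsCW) :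
    (halfSmash X A).IsCW := by
  obtain ⟨hX, ⟨S⟩⟩ := isCW_iff.1 hX
  obtain ⟨hA, ⟨R⟩⟩ := isCW_iff.1 hA
  exact isCW_iff.2 ⟨inferInstance, ⟨S.halfSmash R⟩⟩

theorem isCW_wedge {A B : PtdSpace.{u}} (hA : A.IsCW) (hB : B.IsCW) : (wedge A B).IsCW := by
  obtain ⟨hA, ⟨S⟩⟩ := isCW_iff.1 hA
  obtain ⟨hB, ⟨R⟩⟩ := isCW_iff.1 hB
  exact isCW_iff.2 ⟨inferInstance, ⟨S.wedge R⟩⟩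

end PtdSpace

namespace PtdSpace

open Topology unitInterval

variable {X Y Z W A B : PtdSpace.{u}}

/-! ### Compactly coherent spaces -/

/-- Currying to `E → C(P, V)` reduces the claim to a map out of `E`, whose continuity is tested on
compact sets. -/
theorem continuous_prod_of_compactlyCoherentSpace {E P V : Type*} [TopologicalSpace E]
    [TopologicalSpace P] [TopologicalSpace V] [CompactlyCoherentSpace E] [LocallyCompactSpace P]
    {g : E × P → V} (hg : ∀ K : Set E, IsCompact K → ContinuousOn g (K ×ˢ Set.univ)) :
    Continuous g := by
  have hK : ∀ K : Set E, IsCompact K → Continuous fun p : K × P => g (p.1, p.2) := fun K hK =>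
    (hg K hK).comp_continuous (f := fun p : K × P => ((p.1 : E), p.2)) (by fun_prop)
      fun p => ⟨p.1.2, trivial⟩
  let G : E → C(P, V) := fun e =>
    ⟨_, (hK {e} isCompact_singleton).comp (Continuous.prodMk_right (⟨e, rfl⟩ : ({e} : Set E)))⟩
  have hG : Continuous G := by
    rw [CompactlyCoherentSpace.isCoherentWith.continuous_iff]
    intro K hK'
    rw [continuousOn_iff_continuous_domRestrict]
    exact ContinuousMap.continuous_of_continuous_uncurry _ (hK K hK')
  exact ContinuousMap.continuous_uncurry_of_continuous ⟨G, hG⟩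

instance [CompactlyCoherentSpace X] : CompactlyCoherentSpace X.susp := by
  refine .of_isOpen fun U hU => ?_
  rw [← isQuotientMap_suspMk.isOpen_preimage]
  have : Continuous fun p : X × I => suspMk X p ∈ U := by
    refine continuous_prod_of_compactlyCoherentSpace fun K hK => ?_
    have hc := (hK.prod (isCompact_univ (X := I))).image (continuous_suspMk (X := X))
    have h1 : Continuous fun z : suspMk X '' (K ×ˢ Set.univ) => (z : X.susp) ∈ U :=
      continuous_Prop.2 (hU _ hc)
    rw [continuousOn_iff_continuous_domRestrict]
    exact h1.comp (f := fun p : ↑(K ×ˢ (Set.univ : Set I)) =>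
      (⟨suspMk X p, Set.mem_image_of_mem _ p.2⟩ : suspMk X '' (K ×ˢ Set.univ)))
      ((continuous_suspMk.comp continuous_subtype_val).subtype_mk _)
  exact continuous_Prop.1 this

theorem compactlyCoherentSpace_susp_iterate [h : CompactlyCoherentSpace X] (n : ℕ) :
    CompactlyCoherentSpace (susp^[n] X) := by
  induction n with
  | zero => exact h
  | succ n ih =>
    rw [Function.iterate_succ_apply']
    infer_instance

theorem CellStructure.compactlyCoherentSpace {E : Type u} [TopologicalSpace E]
    (S : CellStructure E) : CompactlyCoherentSpace E := by
  refine .of_isClosed fun C hC => S.isClosed_of C fun i => ?_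
  have h := hC _ ((isCompact_cube _).image_of_continuousOn (S.continuousOn i))
  have hc : Continuous fun v : Cube (S.dim i) =>
      (⟨S.map i v, v, v.2, rfl⟩ : S.map i '' Cube (S.dim i)) :=
    (continuousOn_iff_continuous_domRestrict.1 (S.continuousOn i)).subtype_mk _
  have h2 := (isClosed_cube _).isClosedMap_subtype_val _ (h.preimage hc)
  convert h2 using 1
  ext v
  constructor
  · rintro ⟨h3, h4⟩
    exact ⟨⟨v, h3⟩, h4, rfl⟩
  · rintro ⟨w, h3, rfl⟩
    exact ⟨w.2, h3⟩

theorem IsCW.compactlyCoherentSpace (h : X.IsCW) : CompactlyCoherentSpace X :=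
  (isCW_iff.1 h).2.some.toCellStructure.compactlyCoherentSpace

/-! ### Functoriality of half-smash products -/

theorem continuous_halfSmash_prod {P V : Type*} [TopologicalSpace P] [TopologicalSpace V]
    [LocallyCompactSpace P] {g : halfSmash X A × P → V}
    (hg : ∀ K : Set (X × A), IsCompact K →
      ContinuousOn (fun p : (X × A) × P => g (halfSmashMk X A p.1, p.2)) (K ×ˢ Set.univ)) :
    Continuous g := by
  have hK : ∀ K : Set (X × A), IsCompact K →
      Continuous fun p : K × P => g (halfSmashMk X A p.1, p.2) := fun K hK =>
    (hg K hK).comp_continuous (f := fun p : K × P => ((p.1 : X × A), p.2)) (by fun_prop)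
      fun p => ⟨p.1.2, trivial⟩
  have hs : ∀ z, Continuous fun p => g (z, p) := by
    intro z
    obtain ⟨x, rfl⟩ := halfSmashMk_surjective z
    exact (hK {x} isCompact_singleton).comp
      (Continuous.prodMk_right (⟨x, rfl⟩ : ({x} : Set (X × A))))
  let G : halfSmash X A → C(P, V) := fun z => ⟨_, hs z⟩
  have hG : Continuous G := by
    rw [continuous_halfSmash_iff]
    intro K hK'
    rw [continuousOn_iff_continuous_domRestrict]
    exact ContinuousMap.continuous_of_continuous_uncurry _ (hK K hK')
  exact ContinuousMap.continuous_uncurry_of_continuous ⟨G, hG⟩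

/-- A composition with the projection to the half-smash product is continuous on compact sets. -/
theorem _root_.ContinuousOn.halfSmashMk {E : Type*} [TopologicalSpace E] {K : Set E}
    (hK : IsCompact K) {f : E → X × A} (hf : ContinuousOn f K) :
    ContinuousOn (fun e => halfSmashMk X A (f e)) K :=
  (continuousOn_halfSmashMk (hK.image_of_continuousOn hf)).comp hf (Set.mapsTo_image _ _)

/-- The map out of a half-smash product induced by a map that is constant on `{*} × A`. -/
noncomputable def halfSmashLift (g : X × A → W)
    (hg : ∀ K : Set (X × A), IsCompact K → ContinuousOn g K) (hp : ∀ a, g (X.pt, a) = W.pt) :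
    PMap (halfSmash X A) W where
  toFun := Quotient.lift (fun p => g ((CompactCoherentification.mk (X × A)).symm p)) (by
    rintro p q (rfl | ⟨h, h'⟩)
    · rfl
    · have key : ∀ x : X × A, x.1 = X.pt → g x = W.pt := by
        rintro ⟨x, a⟩ rfl
        exact hp a
      rw [key _ h, key _ h'])
  cont := continuous_halfSmash_iff.2 hg
  map_pt := hp _

@[simp] theorem halfSmashLift_mk (g : X × A → W) (hg hp) (p : X × A) :
    halfSmashLift g hg hp (halfSmashMk X A p) = g p := rfl

/-- Functoriality of the half-smash product in the first variable. -/
noncomputable def PMap.halfSmash (f : PMap X Y) (A : PtdSpace.{u}) :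
    PMap (halfSmash X A) (halfSmash Y A) :=
  halfSmashLift (fun p => halfSmashMk Y A (f p.1, p.2))
    (fun _ hK => ContinuousOn.halfSmashMk hK (by have := f.cont; fun_prop)) (by simp)

@[simp] theorem PMap.halfSmash_mk (f : PMap X Y) (p : X × A) :
    f.halfSmash A (halfSmashMk X A p) = halfSmashMk Y A (f p.1, p.2) := rfl

theorem PMap.Homotopic.halfSmash {f g : PMap X Y} (h : f.Homotopic g) (A : PtdSpace.{u}) :
    (f.halfSmash A).Homotopic (g.halfSmash A) := by
  obtain ⟨H, hc, h0, h1, hp⟩ := homotopic_iff.1 h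
  let G : PtdSpace.halfSmash X A × I → PtdSpace.halfSmash Y A := fun q =>
    PMap.halfSmash ⟨fun x => H (x, q.2), by fun_prop, hp _⟩ A q.1
  have hG : ∀ p t, G (halfSmashMk X A p, t) = halfSmashMk Y A (H (p.1, t), p.2) := fun _ _ => rfl
  refine homotopic_iff.2 ⟨G, ?_, ?_, ?_, ?_⟩
  · refine continuous_halfSmash_prod fun K hK => ?_
    simp only [hG]
    exact ContinuousOn.halfSmashMk (hK.prod isCompact_univ) (by fun_prop)
  · intro x
    obtain ⟨p, rfl⟩ := halfSmashMk_surjective x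
    simp [hG, h0]
  · intro x
    obtain ⟨p, rfl⟩ := halfSmashMk_surjective x
    simp [hG, h1]
  · intro t
    exact PMap.map_pt _

theorem HomotopyEquivalent.halfSmash (h : HomotopyEquivalent X Y) (A : PtdSpace.{u}) :
    HomotopyEquivalent (halfSmash X A) (PtdSpace.halfSmash Y A) := by
  obtain ⟨f, g, h1, h2⟩ := homotopyEquivalent_iff.1 h
  refine homotopyEquivalent_iff.2 ⟨f.halfSmash A, g.halfSmash A, ?_, ?_⟩
  · refine (PMap.Homotopic.of_eq ?_).trans ((h1.halfSmash A).trans (.of_eq ?_)) <;>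
    · ext x
      obtain ⟨p, rfl⟩ := halfSmashMk_surjective x
      rfl
  · refine (PMap.Homotopic.of_eq ?_).trans ((h2.halfSmash A).trans (.of_eq ?_)) <;>
    · ext x
      obtain ⟨p, rfl⟩ := halfSmashMk_surjective x
      rfl

/-- The map `Σ(X ⋊ A) → ΣX ⋊ A`. -/
noncomputable def suspHalfSmash (X A : PtdSpace.{u}) :
    PMap (halfSmash X A).susp (halfSmash X.susp A) :=
  suspLift (fun q => halfSmashLift (fun p => halfSmashMk X.susp A (suspMk X (p.1, q.2), p.2))
      (fun _ hK => ContinuousOn.halfSmashMk hK (by fun_prop)) (by simp) q.1)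
    (continuous_halfSmash_prod fun K hK => by
      simp only [halfSmashLift_mk]
      exact ContinuousOn.halfSmashMk (hK.prod isCompact_univ) (by fun_prop))
    (by
      rintro ⟨x, t⟩ h
      obtain ⟨p, rfl⟩ := halfSmashMk_surjective x
      refine halfSmashMk_eq_pt_iff.2 (suspMk_eq_pt_iff.2 ?_)
      rcases h with h | h
      · exact Or.inl (halfSmashMk_eq_pt_iff.1 h)
      · exact Or.inr h)

@[simp] theorem suspHalfSmash_mk (x : X) (a : A) (t : I) :
    suspHalfSmash X A (suspMk _ (halfSmashMk X A (x, a), t)) =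
      halfSmashMk X.susp A (suspMk X (x, t), a) := rfl

/-- The underlying function of the map `ΣX × A → Σ(X ⋊ A)`. -/
noncomputable def halfSmashSuspFun (X A : PtdSpace.{u}) (q : X.susp × A) : (halfSmash X A).susp :=
  Quotient.lift (fun p : X × I => suspMk (halfSmash X A) (halfSmashMk X A (p.1, q.2), p.2)) (by
    have key : ∀ p ∈ X.suspBase, suspMk (halfSmash X A) (halfSmashMk X A (p.1, q.2), p.2) =
        (halfSmash X A).susp.pt := by
      rintro ⟨x, t⟩ (h | h | h) <;> simp at h <;> subst h <;> simp
    rintro p p' (rfl | h)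
    · rfl
    · exact (key p h.1).trans (key p' h.2).symm) q.1

@[simp] theorem halfSmashSuspFun_mk (p : X × I) (a : A) : halfSmashSuspFun X A (suspMk X p, a) =
    suspMk (halfSmash X A) (halfSmashMk X A (p.1, a), p.2) := rfl

/-- `A` need not be locally compact, so `suspMk X` times the identity of `A` may fail to be a
quotient map. A compact `K` only involves its projection `L` to `A`, which is compact Hausdorff, and
with `L` in place of `A` the quotient argument works. -/
theorem continuousOn_halfSmashSuspFun [CompactlyCoherentSpace X] [T2Space A]
    {K : Set (X.susp × A)} (hK : IsCompact K) : ContinuousOn (halfSmashSuspFun X A) K := by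
  have hL : IsCompact (Prod.snd '' K) := hK.image continuous_snd
  generalize hLK : Prod.snd '' K = L at hL
  have : CompactSpace L := isCompact_iff_compactSpace.1 hL
  have hc : Continuous fun q : X.susp × L => halfSmashSuspFun X A (q.1, q.2) := by
    refine isQuotientMap_suspMk.continuous_lift_prod_left ?_
    have : Continuous fun p : X × (I × L) =>
        suspMk (halfSmash X A) (halfSmashMk X A (p.1, p.2.2), p.2.1) := by
      refine continuous_prod_of_compactlyCoherentSpace fun K' hK' => ?_
      refine continuous_suspMk.comp_continuousOn (ContinuousOn.prodMk ?_ (by fun_prop))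
      exact ContinuousOn.halfSmashMk (hK'.prod isCompact_univ) (by fun_prop)
    exact this.comp (f := fun p : (X × I) × L => (p.1.1, (p.1.2, p.2))) (by fun_prop)
  rw [continuousOn_iff_continuous_domRestrict]
  exact hc.comp (f := fun q : K =>
    (q.1.1, (⟨q.1.2, hLK ▸ Set.mem_image_of_mem _ q.2⟩ : L))) (by fun_prop)

/-- Suspension commutes with half-smash products. -/
theorem susp_halfSmash [CompactlyCoherentSpace X] [T2Space A] :
    HomotopyEquivalent (halfSmash X A).susp (halfSmash X.susp A) := by
  refine .of_inverse (suspHalfSmash X A) (halfSmashLift (halfSmashSuspFun X A)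
    (fun _ hK => continuousOn_halfSmashSuspFun hK) fun a => ?_) ?_ ?_
  · rw [susp_pt, halfSmashSuspFun_mk]
    simp
  · intro z
    obtain ⟨⟨z, t⟩, rfl⟩ := suspMk_surjective z
    obtain ⟨⟨x, a⟩, rfl⟩ := halfSmashMk_surjective z
    rfl
  · intro z
    obtain ⟨⟨z, a⟩, rfl⟩ := halfSmashMk_surjective z
    obtain ⟨⟨x, t⟩, rfl⟩ := suspMk_surjective z
    rfl

theorem susp_iterate_halfSmash [CompactlyCoherentSpace X] [T2Space A] (n : ℕ) :
    HomotopyEquivalent (susp^[n] (halfSmash X A)) (halfSmash (susp^[n] X) A) := by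
  induction n with
  | zero => exact .refl _
  | succ n ih =>
    simp only [Function.iterate_succ_apply']
    have := compactlyCoherentSpace_susp_iterate (X := X) n
    exact ih.susp.trans susp_halfSmash

end PtdSpace

namespace PtdSpace

open Topology unitInterval

/-! ### The recursion for the Whitehead filtration -/

theorem continuous_stage_of {k k' l l' : ℕ} {X : Fin k → PtdSpace.{u}} {X' : Fin k' → PtdSpace.{u}}
    {f : whiteheadStage X l → whiteheadStage X' l'} {φ : (∀ i, X i) → ∀ i, X' i}
    (hφ : Continuous φ) (h : ∀ y, stageVal (f y) = φ (stageVal y)) : Continuous f := by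
  have h1 : Continuous fun y : whiteheadStage X l => CompactCoherentification.map φ y.1 :=
    (CompactCoherentification.continuous_map_of_continuous hφ).comp continuous_subtype_val
  have h2 : Continuous fun y => (f y).1 := h1.congr fun y => (h y).symm
  exact h2.subtype_mk _

/-- In both cases `k - l = k`, so every coordinate is the base point. -/
theorem subsingleton_whiteheadStage {k l : ℕ} {X : Fin k → PtdSpace.{u}} (h : k = 0 ∨ l = 0) :
    Subsingleton (whiteheadStage X l) := by
  have key : ∀ y : whiteheadStage X l, stageVal y = fun i => (X i).pt := by
    intro y
    have h1 : ptIndices (stageVal y) = Set.univ := by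
      refine Set.eq_of_subset_of_ncard_le (Set.subset_univ _) ?_
      have := stageVal_mem y
      rw [Set.ncard_univ, Nat.card_eq_fintype_card, Fintype.card_fin]
      omega
    funext i
    exact (h1 ▸ Set.mem_univ i : i ∈ ptIndices (stageVal y))
  exact ⟨fun a b => stageVal_injective ((key a).trans (key b).symm)⟩

variable {k l : ℕ} {X : Fin (k + 1) → PtdSpace.{u}}

theorem ptIndices_of_eq {x : ∀ i, X i} (h : x 0 = (X 0).pt) :
    (ptIndices x).ncard = (ptIndices (X := fun i => X i.succ) fun i => x i.succ).ncard + 1 := by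
  have : ptIndices x = insert 0 (Fin.succ '' ptIndices (X := fun i => X i.succ)
      fun i => x i.succ) := by
    ext i
    refine Fin.cases ?_ (fun i => ?_) i
    · simp [ptIndices, h]
    · simp [ptIndices, Fin.succ_ne_zero]
  rw [this, Set.ncard_insert_of_notMem (by simp [Fin.succ_ne_zero]),
    Set.ncard_image_of_injective _ (Fin.succ_injective _)]

theorem ptIndices_of_ne {x : ∀ i, X i} (h : x 0 ≠ (X 0).pt) :
    (ptIndices x).ncard = (ptIndices (X := fun i => X i.succ) fun i => x i.succ).ncard := by
  have : ptIndices x = Fin.succ '' ptIndices (X := fun i => X i.succ) fun i => x i.succ := by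
    ext i
    refine Fin.cases ?_ (fun i => ?_) i
    · simp [ptIndices, h, Fin.succ_ne_zero]
    · simp [ptIndices]
  rw [this, Set.ncard_image_of_injective _ (Fin.succ_injective _)]

theorem tail_mem (y : whiteheadStage X (l + 1)) :
    k - (l + 1) ≤ (ptIndices (X := fun i => X i.succ) fun i => stageVal y i.succ).ncard := by
  have h1 := stageVal_mem y
  by_cases h : stageVal y 0 = (X 0).pt
  · rw [ptIndices_of_eq h] at h1
    omega
  · rw [ptIndices_of_ne h] at h1
    omega

theorem tail_mem_of_ne (y : whiteheadStage X (l + 1)) (h : stageVal y 0 ≠ (X 0).pt) :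
    k - l ≤ (ptIndices (X := fun i => X i.succ) fun i => stageVal y i.succ).ncard := by
  have h1 := stageVal_mem y
  rw [ptIndices_of_ne h] at h1
  omega

/-- The tuple with given head and tail. -/
def consTuple (x : X 0) (t : ∀ i : Fin k, X i.succ) : ∀ i, X i := Fin.cons x t

@[simp] theorem consTuple_zero (x : X 0) (t : ∀ i : Fin k, X i.succ) : consTuple x t 0 = x := rfl
@[simp] theorem consTuple_succ (x : X 0) (t : ∀ i : Fin k, X i.succ) (i : Fin k) :
    consTuple x t i.succ = t i := rfl

theorem consTuple_eta (x : ∀ i, X i) : consTuple (x 0) (fun i => x i.succ) = x :=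
  Fin.cons_self_tail x

theorem continuous_consTuple :
    Continuous fun p : X 0 × (∀ i : Fin k, X i.succ) => consTuple p.1 p.2 := by
  refine continuous_pi fun i => ?_
  refine Fin.cases ?_ (fun i => ?_) i
  · exact continuous_fst
  · exact (continuous_apply i).comp continuous_snd

/-- The inclusion of the tuples with trivial head. -/
noncomputable def stageIncl (X : Fin (k + 1) → PtdSpace.{u}) (l : ℕ) :
    PMap (whiteheadStage (fun i : Fin k => X i.succ) (l + 1)) (whiteheadStage X (l + 1)) where
  toFun b := stageMk (consTuple (X 0).pt (stageVal b)) (by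
    have := stageVal_mem b
    rw [ptIndices_of_eq rfl]
    change _ ≤ (ptIndices (stageVal b)).ncard + 1
    omega)
  cont := continuous_stage_of (continuous_consTuple.comp (Continuous.prodMk_right (X 0).pt))
    fun _ => rfl
  map_pt := stageVal_injective (consTuple_eta (X := X) fun i => (X i).pt)

/-- The projection to the tail. -/
noncomputable def stageProj (X : Fin (k + 1) → PtdSpace.{u}) (l : ℕ) :
    PMap (whiteheadStage X (l + 1)) (whiteheadStage (fun i : Fin k => X i.succ) (l + 1)) where
  toFun y := stageMk (fun i => stageVal y i.succ) (tail_mem y)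
  cont := continuous_stage_of (φ := fun x i => x i.succ) (by fun_prop) fun _ => rfl
  map_pt := rfl

theorem mem_range_stageIncl {y : whiteheadStage X (l + 1)} :
    y ∈ Set.range (stageIncl X l) ↔ stageVal y 0 = (X 0).pt := by
  constructor
  · rintro ⟨b, rfl⟩
    rfl
  · intro h
    refine ⟨stageProj X l y, stageVal_injective ?_⟩
    refine Eq.trans ?_ (consTuple_eta (stageVal y))
    rw [h]
    rfl

open Classical in
/-- The underlying function of the projection to the half-smash product. -/
noncomputable def stageQuotFun (X : Fin (k + 1) → PtdSpace.{u}) (l : ℕ)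
    (y : whiteheadStage X (l + 1)) :
    halfSmash (X 0) (whiteheadStage (fun i : Fin k => X i.succ) l) :=
  -- The condition can only fail when the head is the base point, and such points are collapsed
  -- anyway.
  if h : k - l ≤ (ptIndices (X := fun i => X i.succ) fun i => stageVal y i.succ).ncard then
    halfSmashMk _ _ (stageVal y 0, stageMk (fun i => stageVal y i.succ) h)
  else (halfSmash _ _).pt

theorem stageQuotFun_of_le {y : whiteheadStage X (l + 1)}
    (h : k - l ≤ (ptIndices (X := fun i => X i.succ) fun i => stageVal y i.succ).ncard) :
    stageQuotFun X l y = halfSmashMk _ _ (stageVal y 0, stageMk (fun i => stageVal y i.succ) h) :=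
  dif_pos h

theorem stageQuotFun_of_eq {y : whiteheadStage X (l + 1)} (h : stageVal y 0 = (X 0).pt) :
    stageQuotFun X l y = (halfSmash _ _).pt := by
  unfold stageQuotFun
  split_ifs
  · exact halfSmashMk_eq_pt_iff.2 h
  · rfl

/-- The case distinction in `stageQuotFun` is not visibly continuous, but one branch serves each
closed cell: either all tails lie in the stage `l`, or the head is the base point throughout and the
map is constant. -/
theorem continuous_stageQuotFun [∀ i, T2Space (X i)] (S : ∀ i, PtdCellStructure (X i)) :
    Continuous (stageQuotFun X l) := by
  refine (PtdCellStructure.stage S (l + 1)).continuous_of fun c => ?_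
  by_cases hc : k - l ≤
      (PtdCellStructure.baseIndices (fun i : Fin k => S i.succ) fun i => c.1 i.succ).ncard
  · have hm : ∀ v, k - l ≤ (ptIndices (X := fun i => X i.succ)
        fun i => PtdCellStructure.piMap S c.1 v i.succ).ncard := fun v =>
      hc.trans (Set.ncard_le_ncard fun i h => (S i.succ).map_of_eq_base h _)
    have h1 : ContinuousOn (fun v => halfSmashMk (X 0) (whiteheadStage (fun i : Fin k => X i.succ) l)
        (PtdCellStructure.piMap S c.1 v 0, stageMk _ (hm v))) (Cube _) := by
      have h2 := PtdCellStructure.continuousOn_piMap S c.1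
      refine ContinuousOn.halfSmashMk (isCompact_cube _) (ContinuousOn.prodMk ?_ ?_)
      · exact (continuous_apply 0).comp_continuousOn h2
      · refine continuousOn_stage (isCompact_cube _) ?_
        exact continuousOn_pi.2 fun i => (continuous_apply i.succ).comp_continuousOn h2
    exact h1.congr fun v _ => stageQuotFun_of_le (hm v)
  · have h0 : c.1 0 = (S 0).base := by
      by_contra h0
      have h1 := c.2
      have h2 : PtdCellStructure.baseIndices S c.1 = Fin.succ ''
          PtdCellStructure.baseIndices (fun i : Fin k => S i.succ) fun i => c.1 i.succ := by
        ext i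
        refine Fin.cases ?_ (fun i => ?_) i
        · simp [PtdCellStructure.baseIndices, h0, Fin.succ_ne_zero]
        · simp [PtdCellStructure.baseIndices]
      rw [h2, Set.ncard_image_of_injective _ (Fin.succ_injective _)] at h1
      omega
    refine (continuousOn_const (c := (halfSmash _ _).pt)).congr fun v _ => ?_
    exact stageQuotFun_of_eq ((S 0).map_of_eq_base h0 _)

theorem cons_mem (x : X 0) (a : whiteheadStage (fun i : Fin k => X i.succ) l) :
    k + 1 - (l + 1) ≤ (ptIndices (consTuple x (stageVal a))).ncard := by
  have h1 := stageVal_mem a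
  by_cases h : x = (X 0).pt
  · rw [ptIndices_of_eq h]
    change _ ≤ (ptIndices (stageVal a)).ncard + 1
    omega
  · rw [ptIndices_of_ne h]
    change _ ≤ (ptIndices (stageVal a)).ncard
    omega

/-- Composed with the continuous map `s` that joins head and tail, it becomes the defining
projection of the half-smash product, a quotient map. -/
theorem isQuotientMap_stageQuotFun [∀ i, T2Space (X i)] (S : ∀ i, PtdCellStructure (X i)) :
    IsQuotientMap (stageQuotFun X l) := by
  let A := whiteheadStage (fun i : Fin k => X i.succ) l
  let s : X 0 × A → whiteheadStage X (l + 1) := fun p =>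
    stageMk (consTuple p.1 (stageVal p.2)) (cons_mem p.1 p.2)
  have hs : Continuous (s ∘ (CompactCoherentification.mk (X 0 × A)).symm) := by
    refine CompactCoherentification.continuous_dom_iff.2 fun K hK => ?_
    refine continuousOn_stage hK (Continuous.continuousOn ?_)
    exact continuous_consTuple.comp
      (continuous_fst.prodMk (continuous_stageVal.comp continuous_snd))
  have hq : ∀ p, stageQuotFun X l (s p) = halfSmashMk (X 0) A p := fun p =>
    stageQuotFun_of_le (y := s p) (stageVal_mem p.2)
  have e : stageQuotFun X l ∘ (s ∘ (CompactCoherentification.mk (X 0 × A)).symm) =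
      halfSmashMk (X 0) A ∘ (CompactCoherentification.mk (X 0 × A)).symm := funext fun z => hq _
  refine IsQuotientMap.of_comp hs (continuous_stageQuotFun S) ?_
  rw [e]
  exact isQuotientMap_halfSmashMk

/-- A stage splits over the tuples with trivial head. -/
noncomputable def stageCofibreSplit [∀ i, T2Space (X i)] (S : ∀ i, PtdCellStructure (X i))
    (l : ℕ) : CofibreSplit (whiteheadStage (fun i : Fin k => X i.succ) (l + 1))
      (whiteheadStage X (l + 1)) (halfSmash (X 0) (whiteheadStage (fun i : Fin k => X i.succ) l)) where
  j := stageIncl X l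
  p := stageProj X l
  q := ⟨stageQuotFun X l, continuous_stageQuotFun S, stageQuotFun_of_eq rfl⟩
  p_j _ := rfl
  q_j _ := stageQuotFun_of_eq rfl
  isQuotientMap := isQuotientMap_stageQuotFun S
  fibre y y' h := by
    simp only [mem_range_stageIncl]
    change stageQuotFun X l y = stageQuotFun X l y' at h
    by_cases h1 : stageVal y 0 = (X 0).pt
    · rw [stageQuotFun_of_eq h1] at h
      by_cases h2 : stageVal y' 0 = (X 0).pt
      · exact Or.inr ⟨h1, h2⟩
      · rw [stageQuotFun_of_le (tail_mem_of_ne y' h2)] at h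
        exact absurd (halfSmashMk_eq_pt_iff.1 h.symm) h2
    · rw [stageQuotFun_of_le (tail_mem_of_ne y h1)] at h
      by_cases h2 : stageVal y' 0 = (X 0).pt
      · rw [stageQuotFun_of_eq h2] at h
        exact absurd (halfSmashMk_eq_pt_iff.1 h) h1
      · rw [stageQuotFun_of_le (tail_mem_of_ne y' h2)] at h
        rcases halfSmashMk_eq_iff.1 h with h3 | h3
        · left
          refine stageVal_injective ?_
          rw [← consTuple_eta (stageVal y), ← consTuple_eta (stageVal y')]
          exact congrArg₂ consTuple (congrArg Prod.fst h3)
            (congrArg (fun p => stageVal p.2) h3)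
        · exact absurd h3.1 h1
  hep := by
    refine (PtdCellStructure.stage S (l + 1)).hep _ fun c => ?_
    simp only [mem_range_stageIncl]
    by_cases hc : c.1 0 = (S 0).base
    · exact Or.inl fun v _ => (S 0).map_of_eq_base hc _
    · exact Or.inr fun v hv h => hc ((S 0).eq_base_of_map ((norm_block_lt_iff _ _).1 hv 0) h)

/-- The first stage is a wedge. -/
theorem whiteheadStage_one [∀ i, T2Space (X i)] (S : PtdCellStructure (X 0)) :
    HomotopyEquivalent (whiteheadStage X 1)
      (wedge (whiteheadStage (fun i : Fin k => X i.succ) 1) (X 0)) := by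
  -- A point of the first stage with nontrivial head has its tail in stage 0, a single point; this
  -- makes the stage a wedge.
  have hsub : Subsingleton (whiteheadStage (fun i : Fin k => X i.succ) 0) :=
    subsingleton_whiteheadStage (Or.inr rfl)
  have hpt : ∀ y : whiteheadStage X 1, stageVal y 0 ≠ (X 0).pt →
      ∀ i : Fin k, stageVal y i.succ = (X i.succ).pt := fun y h i =>
    congrFun (congrArg stageVal (Subsingleton.elim (stageMk _ (tail_mem_of_ne y h))
      (whiteheadStage (fun i : Fin k => X i.succ) 0).pt)) i
  let f : PMap (whiteheadStage X 1) (wedge (whiteheadStage (fun i : Fin k => X i.succ) 1) (X 0)) :=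
    { toFun := fun y => ⟨(stageProj X 0 y, stageVal y 0), by
        by_cases h : stageVal y 0 = (X 0).pt
        · exact Or.inr h
        · exact Or.inl (stageVal_injective (funext (hpt y h)))⟩
      cont := by
        refine Continuous.subtype_mk ?_ _
        exact (stageProj X 0).cont.prodMk ((continuous_apply 0).comp continuous_stageVal)
      map_pt := rfl }
  let g : PMap (X 0) (whiteheadStage X 1) :=
    { toFun := fun x => stageMk (consTuple x fun i => (X i.succ).pt)
        (cons_mem x (whiteheadStage (fun i : Fin k => X i.succ) 0).pt)
      -- The stage has a k-ified topology, so continuity into it is checked on the compact cells of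
      -- `X 0`.
      cont := S.continuous_of fun i => continuousOn_stage (isCompact_cube _) (by
        exact continuous_consTuple.comp_continuousOn
          ((S.continuousOn i).prodMk continuousOn_const))
      map_pt := stageVal_injective (consTuple_eta (X := X) fun i => (X i).pt) }
  refine .of_inverse f (wedgeDesc (stageIncl X 0) g) ?_ ?_
  · intro y
    by_cases h : stageVal y 0 = (X 0).pt
    · obtain ⟨b, rfl⟩ := mem_range_stageIncl.2 h
      exact wedgeDesc_inl _ _ b
    · have h1 : f y = wedgeInr _ _ (stageVal y 0) :=
        Subtype.ext (Prod.ext (stageVal_injective (funext (hpt y h))) rfl)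
      rw [h1, wedgeDesc_inr]
      refine stageVal_injective ?_
      rw [← consTuple_eta (stageVal y)]
      exact congrArg (consTuple _) (funext fun i => (hpt y h i).symm)
  · intro z
    rcases wedge_cases z with ⟨b, rfl⟩ | ⟨x, rfl⟩
    · rw [wedgeDesc_inl]
      rfl
    · rw [wedgeDesc_inr]
      rfl

/-! ### `SⁿS`-spaces -/

theorem IsSnS.isCW {n : ℕ} {X : PtdSpace.{u}} (h : X.IsSnS n) : X.IsCW := h.1

theorem IsCW.t2Space {X : PtdSpace.{u}} (h : X.IsCW) : T2Space X := h.1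

/-- A wedge of spaces that are equivalent to `n + 1`-fold suspensions is equivalent to one. -/
theorem exists_of_wedge {n : ℕ} {V W A B : PtdSpace.{u}} (hA : A.IsCW) (hB : B.IsCW)
    (h1 : HomotopyEquivalent V (susp^[n + 1] A)) (h2 : HomotopyEquivalent W (susp^[n + 1] B)) :
    ∃ Y : PtdSpace.{u}, Y.IsCW ∧ HomotopyEquivalent (wedge V W) (susp^[n + 1] Y) := by
  have := hA.t2Space
  have := hB.t2Space
  exact ⟨wedge A B, isCW_wedge hA hB, (h1.wedge h2).trans (susp_iterate_wedge (n + 1)).symm⟩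

/-- `l ≤ k` is not assumed, because the induction step passes from `(k + 1, l + 1)` to `(k, l + 1)`.
For `l > k` the truncated `k - l` is 0 and the stage is the whole product. -/
theorem isSnS_whiteheadStage (n k : ℕ) : ∀ (l : ℕ), (1 ≤ n ∨ l ≤ 1) →
    ∀ X : Fin k → PtdSpace.{u}, (∀ i, (X i).IsSnS n) → (whiteheadStage X l).IsSnS n := by
  induction k with
  | zero =>
    intro l _ X hX
    have := subsingleton_whiteheadStage (X := X) (l := l) (Or.inl rfl)
    have hT := isCW_whiteheadStage (l := l) fun i => (hX i).isCW
    exact ⟨hT, _, hT, .of_subsingleton⟩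
  | succ k ih =>
    intro l hn X hX
    have hT := isCW_whiteheadStage (l := l) fun i => (hX i).isCW
    refine ⟨hT, ?_⟩
    rcases l with _ | l
    · have := subsingleton_whiteheadStage (X := X) (l := 0) (Or.inr rfl)
      -- The one-point stage serves as its own desuspension.
      exact ⟨_, hT, .of_subsingleton⟩
    have hX2 : ∀ i, T2Space (X i) := fun i => (hX i).isCW.t2Space
    let S : ∀ i, PtdCellStructure (X i) := fun i => (isCW_iff.1 (hX i).isCW).2.some
    obtain ⟨-, YB, hYB, hB⟩ := ih (l + 1) hn (fun i => X i.succ) fun i => hX i.succ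
    obtain ⟨-, Y, hY, hXY⟩ := hX 0
    rcases n with _ | n
    · obtain rfl : l = 0 := by omega
      obtain ⟨V, hV, h⟩ := exists_of_wedge hYB hY hB hXY
      exact ⟨V, hV, (whiteheadStage_one (S 0)).trans h⟩
    · have hA := isCW_whiteheadStage (X := fun i => X i.succ) (l := l) fun i => (hX i.succ).isCW
      have := hA.t2Space
      have := hY.compactlyCoherentSpace
      have := (hX 0).isCW.compactlyCoherentSpace
      -- The suspensions are moved onto `X 0`, where the equivalence with a suspension of `Y`
      -- applies, and then moved out again; the desuspension is `halfSmash Y A`.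
      have hQ := ((susp_iterate_halfSmash (X := X 0)
        (A := whiteheadStage (fun i => X i.succ) l) (n + 1)).trans (hXY.halfSmash _)).trans
          (susp_iterate_halfSmash (n + 1 + 1)).symm
      obtain ⟨V, hV, h⟩ := exists_of_wedge hYB (isCW_halfSmash hY hA) hB hQ
      refine ⟨V, hV, HomotopyEquivalent.trans ?_ h⟩
      -- One of the `n + 1` suspensions is spent on the splitting; the other `n` are distributed
      -- over the wedge.
      exact ((stageCofibreSplit S l).susp_homotopyEquivalent.susp_iterate n).trans
        (susp_iterate_wedge n)

end PtdSpace

theorem mainTheorem11 (n k l : ℕ) (hl : l ≤ k) (hn : 1 ≤ n ∨ l ≤ 1)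
    (X : Fin k → PtdSpace.{u}) (hX : ∀ i, (X i).IsSnS n) :
    (PtdSpace.whiteheadStage X l).IsSnS n :=
  PtdSpace.isSnS_whiteheadStage n k l hn X hX
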